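/- Let $\mathcal C$ be a braided monoidal category (tensor product $\otimes$, unit object $K$, braiding $c$; associativity and unit constraints are suppressed, and the identity of an object is denoted by the object) in which all idempotents split and all coequalizers exist. **Definitions.** A *unital magma* $(A,\eta_A,\mu_A)$ satisfies $\mu_A(\eta_A\otimes A)=\mathrm{id}_A=\mu_A(A\otimes\eta_A)$; associativity is not required. For a comonoid $D$, a unital magma $A$ and $f,g:D\to A$, put $f*g=\mu_A(f\otimes g)\delta_D$. A *weak Hopf quasigroup* is a unital magma and comonoid $(H,\eta,\mu,\varepsilon,\delta)$ with a morphism $\lambda:H\to H$ such that, with $\Pi^L=\mathrm{id}_H*\lambda$ and $\Pi^R=\lambda*\mathrm{id}_H$: * $\delta\mu=(\mu\otimes\mu)(H\otimes c_{H,H}\otimes H)(\delta\otimes\delta)$; * $\varepsilon\mu(\mu\otimes H)=\varepsilon\mu(H\otimes\mu)=(\varepsilon\mu\otimes\varepsilon\mu)(H\otimes\delta\otimes H)=(\varepsilon\mu\otimes\varepsilon\mu)(H\otimes c_{H,H}^{-1}\delta\otimes H)$; * $(\delta\otimes H)\delta\eta=(H\otimes\mu\otimes H)(\delta\eta\otimes\delta\eta)=(H\otimes\mu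 c_{H,H}^{-1}\otimes H)(\delta\eta\otimes\delta\eta)$; * $\Pi^L=(\varepsilon\mu\otimes H)(H\otimes c_{H,H})(\delta\eta\otimes H)$ and $\Pi^R=(H\otimes\varepsilon\mu)(c_{H,H}\otimes H)(H\otimes\delta\eta)$; * $\lambda*\Pi^L=\lambda=\Pi^R*\lambda$; * $\mu(\lambda\otimes\mu)(\delta\otimes H)=\mu(\Pi^R\otimes H)$ and $\mu(H\otimes\mu)(H\otimes\lambda\otimes H)(\delta\otimes H)=\mu(\Pi^L\otimes H)$; * $\mu(\mu\otimes\lambda)(H\otimes\delta)=\mu(H\otimes\Pi^L)$ and $\mu(\mu\otimes H)(H\otimes\lambda\otimes H)(H\otimes\delta)=\mu(H\otimes\Pi^R)$. A *right $H$-comodule magma* is a unital magma $B$ with a right $H$-comodule structure $\rho_B:B\to B\otimes H$ such that $\rho_B\mu_B=(\mu_B\otimes\mu_H)(B\otimes c_{H,B}\otimes H)(\rho_B\otimes\rho_B)$ and $(B\otimes\Pi^L)\rho_B\eta_B=\rho_B\eta_B$. An *anchor morphism* is a morphism $h:H\to B$ of right $H$-comodules and of unital magmas with $$\mu_B\big(\mu_B(B\otimes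 h)\otimes h\lambda\big)(B\otimes\delta)=\mu_B(B\otimes h\Pi^L),\qquad \mu_B\big(\mu_B(B\otimes h\lambda)\otimes h\big)(B\otimes\delta)=\mu_B(B\otimes h\Pi^R).$$ Put $q_B=\mu_B(B\otimes h\lambda)\rho_B$. When $q_B$ is idempotent, let $B^{coH}$ be its image, with $i_B:B^{coH}\to B$, $p_B:B\to B^{coH}$, $i_Bp_B=q_B$, $p_Bi_B=\mathrm{id}$. A *strong $(H,B,h)$-Hopf module* is a right $H$-comodule $(M,\rho_M)$ with a morphism $\phi_M:M\otimes B\to M$ such that * $\phi_M(M\otimes\eta_B)=\mathrm{id}_M$; * $\phi_M(\phi_M(M\otimes i_B)\otimes B)=\phi_M(M\otimes\mu_B(i_B\otimes B))$; * $\rho_M\phi_M=(\phi_M\otimes\mu_H)(M\otimes c_{H,B}\otimes H)(\rho_M\otimes\rho_B)$; * $\phi_M(\phi_M(M\otimes h)\otimes h\lambda)(M\otimes\delta)=\phi_M(M\otimes h\Pi^L)$; * $\phi_M(\phi_M(M\otimes h\lambda)\otimes h)(M\otimes\delta)=\phi_M(M\otimes h\Pi^R)$. Let $M^{coH}$, with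 $i_M,p_M$, denote the image of $q_M=\phi_M(M\otimes h\lambda)\rho_M$. It carries the morphism $\phi_{M^{coH}}=p_M\phi_M(i_M\otimes i_B):M^{coH}\otimes B^{coH}\to M^{coH}$. For an object $N$ with a morphism $\psi_N:N\otimes B^{coH}\to N$ let $n_N:N\otimes B\to N\otimes_{B^{coH}}B$ be the coequalizer of $\psi_N\otimes B$ and $N\otimes\mu_B(i_B\otimes B)$. Its *induced* action $\phi$ and coaction $\rho$ are the morphisms with $\phi(n_N\otimes B)=n_N(N\otimes\mu_B)$ and $\rho\, n_N=(n_N\otimes H)(N\otimes\rho_B)$. **Theorem.** Let $H$ be a weak Hopf quasigroup, $B$ a right $H$-comodule magma and $h:H\to B$ an anchor morphism, and suppose that $-\otimes B$ and $-\otimes H$ preserve coequalizers. Then $q_B$ is idempotent. Suppose moreover that $$\mu_B(\mu_B(B\otimes i_B)\otimes B)=\mu_B(B\otimes\mu_B(i_B\otimes B)),\qquad \mu_B(i_B\otimes\mu_B)=\mu_B(\mu_B(i_B\otimes B)\otimes B).$$ Then: 1. $B^{coH}$ has a monoid structure with $i_B\eta_{B^{coH}}=\eta_B$ and $i_B\mu_{B^{coH}}=\mu_B(i_B\otimes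 i_B)$. Let $\mathcal C_{B^{coH}}$ be the category of right $B^{coH}$-modules. 2. For every strong $(H,B,h)$-Hopf module $M$, $q_M$ is idempotent, $M^{coH}\otimes_{B^{coH}}B$ has an induced action $\phi$ and an induced coaction, and there is an isomorphism $\omega_M:M^{coH}\otimes_{B^{coH}}B\to M$, compatible with the coactions, with $\omega_Mn_{M^{coH}}=\phi_M(i_M\otimes B)$. The morphism $\phi_M^{\omega_M}=\omega_M\,\phi\,(\omega_M^{-1}\otimes B)$ does not depend on the choice of the image and of the coequalizer. Let $\mathcal{SM}^H_B(h)$ be the category of strong $(H,B,h)$-Hopf modules, whose morphisms $f:M\to Q$ are the morphisms of right $H$-comodules with $\phi_Q^{\omega_Q}(f\otimes B)=f\phi_M^{\omega_M}$. 3. There are an induction functor $F=-\otimes_{B^{coH}}B:\mathcal C_{B^{coH}}\to\mathcal{SM}^H_B(h)$, where $F(N)=N\otimes_{B^{coH}}B$ has the induced action and coaction and $F(f)n_N=n_P(f\otimes B)$ for $f:N\to P$, and a coinvariants functor $G=(-)^{coH}:\mathcal{SM}^H_B(h)\to\mathcal C_{B^{coH}}$, where $G(M)=(M^{coH},\phi_{M^{coH}})$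 and $i_QG(g)=g\,i_M$ for $g:M\to Q$. 4. $F$ is left adjoint to $G$, with unit $\alpha$ and counit $\beta$ determined by $i_{F(N)}\alpha_N=n_N(N\otimes\eta_B)$ and $\beta_M n_{M^{coH}}=\phi_M(i_M\otimes B)$, and $\alpha$ and $\beta$ are natural isomorphisms. 5. Hence the categories $\mathcal{SM}^H_B(h)$ and $\mathcal C_{B^{coH}}$ are equivalent. -/

import Mathlib

open CategoryTheory MonoidalCategory Limits
open scoped ComonObj

namespace WeakDoiHopf

universe v u

/-- A unital magma in a monoidal category: an object with a unit and a product that satisfies the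
two unit laws; associativity is not required. -/
class UnitalMagma {C : Type u} [Category.{v} C] [MonoidalCategory C] (A : C) where
  unit : 𝟙_ C ⟶ A
  mul : A ⊗ A ⟶ A
  unit_mul : unit ▷ A ≫ mul = (λ_ A).hom
  mul_unit : A ◁ unit ≫ mul = (ρ_ A).hom

/-- The unit of a unital magma. -/
notation "uη[" X "]" => UnitalMagma.unit (A := X)

/-- The product of a unital magma. -/
notation "uμ[" X "]" => UnitalMagma.mul (A := X)

section

variable {C : Type u} [Category.{v} C] [MonoidalCategory C]

/-- The convolution product `f ∗ g = μ ∘ (f ⊗ g) ∘ δ`. -/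
def conv {D A : C} [ComonObj D] [UnitalMagma A] (f g : D ⟶ A) : D ⟶ A :=
  Δ[D] ≫ (f ⊗ₘ g) ≫ uμ[A]

/-- Morphisms of unital magmas. -/
structure IsMagmaHom {A A' : C} [UnitalMagma A] [UnitalMagma A'] (f : A ⟶ A') : Prop where
  unit : uη[A] ≫ f = uη[A']
  mul : uμ[A] ≫ f = (f ⊗ₘ f) ≫ uμ[A']

/-- `coact : M ⟶ M ⊗ D` makes `M` a right comodule over the comonoid `D`. -/
structure IsRightComodule (D : C) [ComonObj D] {M : C} (coact : M ⟶ M ⊗ D) : Prop where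
  counit : coact ≫ M ◁ ε[D] = (ρ_ M).inv
  coassoc : coact ≫ M ◁ Δ[D] = coact ≫ coact ▷ D ≫ (α_ M D D).hom

/-- A factorization of an endomorphism `q` through an object (the image of `q`):
`q = i ∘ p` and `p ∘ i = id`. -/
structure Splitting {Y : C} (q : Y ⟶ Y) where
  obj : C
  i : obj ⟶ Y
  p : Y ⟶ obj
  p_i : p ≫ i = q
  i_p : i ≫ p = 𝟙 obj

/-- A right module over a monoid `A` of `C`. -/
structure RightModule (A : C) [MonObj A] where
  X : C
  act : X ⊗ A ⟶ X
  act_one : X ◁ MonObj.one (X := A) ≫ act = (ρ_ X).hom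
  act_mul : act ▷ A ≫ act = (α_ X A A).hom ≫ X ◁ MonObj.mul (X := A) ≫ act

/-- Morphisms of right `A`-modules. -/
@[ext]
structure RightModule.Hom {A : C} [MonObj A] (N P : RightModule A) where
  hom : N.X ⟶ P.X
  linear : N.act ≫ hom = hom ▷ A ≫ P.act

/-- The category of right `A`-modules. -/
instance {A : C} [MonObj A] : Category (RightModule A) where
  Hom N P := RightModule.Hom N P
  id N := ⟨𝟙 N.X, by simp⟩
  comp f g := ⟨f.hom ≫ g.hom, by
    rw [← Category.assoc, f.linear, Category.assoc, g.linear, comp_whiskerRight, Category.assoc]⟩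

end

section

variable {C : Type u} [Category.{v} C] [MonoidalCategory C] [BraidedCategory C]

/-- A weak Hopf quasigroup: a unital magma and comonoid `H` with an antipode, subject to the
axioms below. As usual the associativity and unit constraints are left implicit; `⊗≫` is
composition up to these constraints. -/
class WeakHopfQuasigroup (H : C) [UnitalMagma H] [ComonObj H] where
  /-- `δ ∘ μ = (μ ⊗ μ) ∘ δ_{H ⊗ H}` -/
  mul_comul : uμ[H] ≫ Δ[H] = (Δ[H] ⊗ₘ Δ[H]) ≫ tensorμ H H H H ≫ (uμ[H] ⊗ₘ uμ[H])
  counit_mul_mul : uμ[H] ▷ H ≫ uμ[H] ≫ ε[H] = (α_ H H H).hom ≫ H ◁ uμ[H] ≫ uμ[H] ≫ ε[H]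
  /-- `ε ∘ μ ∘ (μ ⊗ H) = ((ε ∘ μ) ⊗ (ε ∘ μ)) ∘ (H ⊗ δ ⊗ H)` -/
  counit_mul_mul_comul : uμ[H] ▷ H ≫ uμ[H] ≫ ε[H] =
    (H ◁ Δ[H]) ▷ H ⊗≫ ((uμ[H] ≫ ε[H]) ⊗ₘ (uμ[H] ≫ ε[H])) ≫ (λ_ (𝟙_ C)).hom
  /-- `ε ∘ μ ∘ (μ ⊗ H) = ((ε ∘ μ) ⊗ (ε ∘ μ)) ∘ (H ⊗ (c⁻¹ ∘ δ) ⊗ H)` -/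
  counit_mul_mul_braid : uμ[H] ▷ H ≫ uμ[H] ≫ ε[H] =
    (H ◁ (Δ[H] ≫ (β_ H H).inv)) ▷ H ⊗≫ ((uμ[H] ≫ ε[H]) ⊗ₘ (uμ[H] ≫ ε[H])) ≫ (λ_ (𝟙_ C)).hom
  /-- `(δ ⊗ H) ∘ δ ∘ η = (H ⊗ μ ⊗ H) ∘ ((δ ∘ η) ⊗ (δ ∘ η))` -/
  comul_comul_unit : uη[H] ≫ Δ[H] ≫ Δ[H] ▷ H =
    (λ_ (𝟙_ C)).inv ≫ ((uη[H] ≫ Δ[H]) ⊗ₘ (uη[H] ≫ Δ[H])) ⊗≫ (H ◁ uμ[H]) ▷ H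
  /-- `(δ ⊗ H) ∘ δ ∘ η = (H ⊗ (μ ∘ c⁻¹) ⊗ H) ∘ ((δ ∘ η) ⊗ (δ ∘ η))` -/
  comul_comul_unit_braid : uη[H] ≫ Δ[H] ≫ Δ[H] ▷ H =
    (λ_ (𝟙_ C)).inv ≫ ((uη[H] ≫ Δ[H]) ⊗ₘ (uη[H] ≫ Δ[H])) ⊗≫ (H ◁ ((β_ H H).inv ≫ uμ[H])) ▷ H
  /-- the antipode `λ` -/
  antipode : H ⟶ H
  /-- `id ∗ λ = ((ε ∘ μ) ⊗ H) ∘ (H ⊗ c) ∘ ((δ ∘ η) ⊗ H)` -/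
  target_eq : conv (𝟙 H) antipode =
    (λ_ H).inv ≫ (uη[H] ≫ Δ[H]) ▷ H ⊗≫ H ◁ (β_ H H).hom ⊗≫ (uμ[H] ≫ ε[H]) ▷ H ≫ (λ_ H).hom
  /-- `λ ∗ id = (H ⊗ (ε ∘ μ)) ∘ (c ⊗ H) ∘ (H ⊗ (δ ∘ η))` -/
  source_eq : conv antipode (𝟙 H) =
    (ρ_ H).inv ≫ H ◁ (uη[H] ≫ Δ[H]) ⊗≫ (β_ H H).hom ▷ H ⊗≫ H ◁ (uμ[H] ≫ ε[H]) ≫ (ρ_ H).hom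
  antipode_target : conv antipode (conv (𝟙 H) antipode) = antipode
  source_antipode : conv (conv antipode (𝟙 H)) antipode = antipode
  /-- `μ ∘ (λ ⊗ μ) ∘ (δ ⊗ H) = μ ∘ ((λ ∗ id) ⊗ H)` -/
  antipode_left : Δ[H] ▷ H ⊗≫ (antipode ⊗ₘ uμ[H]) ≫ uμ[H] =
    conv antipode (𝟙 H) ▷ H ≫ uμ[H]
  /-- `μ ∘ (H ⊗ μ) ∘ (H ⊗ λ ⊗ H) ∘ (δ ⊗ H) = μ ∘ ((id ∗ λ) ⊗ H)` -/
  antipode_left' : Δ[H] ▷ H ⊗≫ H ◁ (antipode ▷ H) ≫ H ◁ uμ[H] ≫ uμ[H] =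
    conv (𝟙 H) antipode ▷ H ≫ uμ[H]
  /-- `μ ∘ (μ ⊗ λ) ∘ (H ⊗ δ) = μ ∘ (H ⊗ (id ∗ λ))` -/
  antipode_right : H ◁ Δ[H] ⊗≫ (uμ[H] ⊗ₘ antipode) ≫ uμ[H] =
    H ◁ conv (𝟙 H) antipode ≫ uμ[H]
  /-- `μ ∘ (μ ⊗ H) ∘ (H ⊗ λ ⊗ H) ∘ (H ⊗ δ) = μ ∘ (H ⊗ (λ ∗ id))` -/
  antipode_right' : H ◁ Δ[H] ⊗≫ (H ◁ antipode) ▷ H ≫ uμ[H] ▷ H ≫ uμ[H] =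
    H ◁ conv antipode (𝟙 H) ≫ uμ[H]

/-- The antipode of a weak Hopf quasigroup. -/
abbrev antipode (H : C) [UnitalMagma H] [ComonObj H] [WeakHopfQuasigroup H] : H ⟶ H :=
  WeakHopfQuasigroup.antipode

/-- The target morphism `id ∗ λ`. -/
def piL (H : C) [UnitalMagma H] [ComonObj H] [WeakHopfQuasigroup H] : H ⟶ H :=
  conv (𝟙 H) (antipode H)

/-- The source morphism `λ ∗ id`. -/
def piR (H : C) [UnitalMagma H] [ComonObj H] [WeakHopfQuasigroup H] : H ⟶ H :=
  conv (antipode H) (𝟙 H)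

/-- A right `H`-comodule magma: a unital magma and right `H`-comodule `B` whose coaction is
multiplicative and (weakly) unital. The weak unitality of the coaction has several well-known
equivalent forms; the one used here is `(B ⊗ Π^L) ∘ ρ ∘ η = ρ ∘ η`. -/
class ComoduleMagma (H B : C) [UnitalMagma H] [ComonObj H] [WeakHopfQuasigroup H]
    [UnitalMagma B] where
  coact : B ⟶ B ⊗ H
  comodule : IsRightComodule H coact
  /-- `μ_{B ⊗ H} ∘ (ρ ⊗ ρ) = ρ ∘ μ` -/
  mul_coact : (coact ⊗ₘ coact) ≫ tensorμ B H B H ≫ (uμ[B] ⊗ₘ uμ[H]) = uμ[B] ≫ coact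
  unit_coact : uη[B] ≫ coact ≫ B ◁ piL H = uη[B] ≫ coact

variable {H B : C} [UnitalMagma H] [ComonObj H] [WeakHopfQuasigroup H] [UnitalMagma B]

/-- The coaction `B ⟶ B ⊗ H` of a right `H`-comodule magma `B`. -/
abbrev coactB (H B : C) [UnitalMagma H] [ComonObj H] [WeakHopfQuasigroup H] [UnitalMagma B]
    [ComoduleMagma H B] : B ⟶ B ⊗ H :=
  ComoduleMagma.coact

/-- Anchor morphisms `h : H ⟶ B`: multiplicative total integrals satisfying two cancellation
conditions. -/
structure IsAnchor [ComoduleMagma H B] (h : H ⟶ B) : Prop where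
  colinear : h ≫ coactB H B = Δ[H] ≫ h ▷ H
  magmaHom : IsMagmaHom h
  /-- `μ ∘ ((μ ∘ (B ⊗ h)) ⊗ (h ∘ λ)) ∘ (B ⊗ δ) = μ ∘ (B ⊗ (h ∘ Π^L))` -/
  mul_target : B ◁ Δ[H] ⊗≫ ((B ◁ h ≫ uμ[B]) ⊗ₘ (antipode H ≫ h)) ≫ uμ[B] =
    B ◁ (piL H ≫ h) ≫ uμ[B]
  /-- `μ ∘ ((μ ∘ (B ⊗ (h ∘ λ))) ⊗ h) ∘ (B ⊗ δ) = μ ∘ (B ⊗ (h ∘ Π^R))` -/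
  mul_source : B ◁ Δ[H] ⊗≫ ((B ◁ (antipode H ≫ h) ≫ uμ[B]) ⊗ₘ h) ≫ uμ[B] =
    B ◁ (piR H ≫ h) ≫ uμ[B]

/-- The endomorphism `q = act ∘ (M ⊗ (h ∘ λ)) ∘ coact` of `M`. -/
def coinvEndo (h : H ⟶ B) {M : C} (act : M ⊗ B ⟶ M) (coact : M ⟶ M ⊗ H) : M ⟶ M :=
  coact ≫ M ◁ (antipode H ≫ h) ≫ act

variable [ComoduleMagma H B]

/-- The object of coinvariants `B^{co H}`, with its morphisms `i_B`, `p_B`: an image of the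
endomorphism `q_B = μ ∘ (B ⊗ (h ∘ λ)) ∘ ρ` of `B`. -/
abbrev BCoinv (h : H ⟶ B) := Splitting (coinvEndo h uμ[B] (coactB H B))

/-- Strong `(H, B, h)`-Hopf modules; `S` is the chosen `B^{co H}`. -/
structure StrongHopfModule (h : H ⟶ B) (S : BCoinv h) where
  X : C
  act : X ⊗ B ⟶ X
  coact : X ⟶ X ⊗ H
  comodule : IsRightComodule H coact
  act_unit : X ◁ uη[B] ≫ act = (ρ_ X).hom
  /-- `φ ∘ ((φ ∘ (M ⊗ i_B)) ⊗ B) = φ ∘ (M ⊗ (μ ∘ (i_B ⊗ B)))` -/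
  act_coinv : (X ◁ S.i ≫ act) ▷ B ≫ act = (α_ X S.obj B).hom ≫ X ◁ (S.i ▷ B ≫ uμ[B]) ≫ act
  /-- `ρ_M ∘ φ = (φ ⊗ μ_H) ∘ (M ⊗ c_{H,B} ⊗ H) ∘ (ρ_M ⊗ ρ_B)` -/
  act_coact : act ≫ coact = (coact ⊗ₘ coactB H B) ≫ tensorμ X H B H ≫ (act ⊗ₘ uμ[H])
  /-- `φ ∘ ((φ ∘ (M ⊗ h)) ⊗ (h ∘ λ)) ∘ (M ⊗ δ) = φ ∘ (M ⊗ (h ∘ Π^L))` -/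
  act_target : X ◁ Δ[H] ⊗≫ ((X ◁ h ≫ act) ⊗ₘ (antipode H ≫ h)) ≫ act =
    X ◁ (piL H ≫ h) ≫ act
  /-- `φ ∘ ((φ ∘ (M ⊗ (h ∘ λ))) ⊗ h) ∘ (M ⊗ δ) = φ ∘ (M ⊗ (h ∘ Π^R))` -/
  act_source : X ◁ Δ[H] ⊗≫ ((X ◁ (antipode H ≫ h) ≫ act) ⊗ₘ h) ≫ act =
    X ◁ (piR H ≫ h) ≫ act

/-- `n : N ⊗ B ⟶ T` exhibits `T` as `N ⊗_{B^{co H}} B`: it is a coequalizer of `ψ ⊗ B` and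
`N ⊗ (μ ∘ (i_B ⊗ B))`. -/
def IsBalancedTensor {h : H ⟶ B} (S : BCoinv h) {N T : C} (ψ : N ⊗ S.obj ⟶ N)
    (n : N ⊗ B ⟶ T) : Prop :=
  ∃ w : ψ ▷ B ≫ n = ((α_ N S.obj B).hom ≫ N ◁ (S.i ▷ B ≫ uμ[B])) ≫ n,
    Nonempty (IsColimit (Cofork.ofπ n w))

/-- The action `tact` and the coaction `tcoact` on `T = N ⊗_{B^{co H}} B` are induced, along
`n : N ⊗ B ⟶ T`, by the product and the coaction of `B`. -/
structure IsInducedStructure {N T : C} (n : N ⊗ B ⟶ T) (tact : T ⊗ B ⟶ T)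
    (tcoact : T ⟶ T ⊗ H) : Prop where
  act : n ▷ B ≫ tact = (α_ N B B).hom ≫ N ◁ uμ[B] ≫ n
  coact : n ≫ tcoact = N ◁ coactB H B ≫ (α_ N B H).inv ≫ n ▷ H

namespace StrongHopfModule

variable {h : H ⟶ B} {S : BCoinv h}

/-- The endomorphism `q_M = φ ∘ (M ⊗ (h ∘ λ)) ∘ ρ_M` of a strong Hopf module. -/
def q (M : StrongHopfModule h S) : M.X ⟶ M.X := coinvEndo h M.act M.coact

/-- For an image of `q_M` (the object of coinvariants `M^{co H}`), the morphism
`p_M ∘ φ ∘ (i_M ⊗ i_B) : M^{co H} ⊗ B^{co H} ⟶ M^{co H}`. -/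
def coinvAct (M : StrongHopfModule h S) (s : Splitting M.q) : s.obj ⊗ S.obj ⟶ s.obj :=
  (s.i ⊗ₘ S.i) ≫ M.act ≫ s.p

/-- The coinvariants `M^{co H}`, the tensor product `T = M^{co H} ⊗_{B^{co H}} B` with its induced
action and coaction, and the comparison isomorphism of right `H`-comodules `ω : T ≅ M` with
`ω ∘ n = φ ∘ (i_M ⊗ B)`. -/
structure Comparison (M : StrongHopfModule h S) where
  coinv : Splitting M.q
  T : C
  n : coinv.obj ⊗ B ⟶ T
  isBalancedTensor : IsBalancedTensor S (M.coinvAct coinv) n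
  tact : T ⊗ B ⟶ T
  tcoact : T ⟶ T ⊗ H
  induced : IsInducedStructure n tact tcoact
  ω : T ≅ M.X
  n_ω : n ≫ ω.hom = coinv.i ▷ B ≫ M.act
  ω_colinear : ω.hom ≫ M.coact = tcoact ≫ ω.hom ▷ H

/-- The transported action `ω ∘ φ_T ∘ (ω⁻¹ ⊗ B)`, where `T = M^{co H} ⊗_{B^{co H}} B`. -/
def Comparison.deformed {M : StrongHopfModule h S} (D : M.Comparison) : M.X ⊗ B ⟶ M.X :=
  D.ω.inv ▷ B ≫ D.tact ≫ D.ω.hom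

open scoped Classical in
/-- The deformed action `φ_M^ω = ω ∘ φ_T ∘ (ω⁻¹ ⊗ B)` of a strong Hopf module. (Where no
comparison isomorphism exists, the value is the conventional one `φ_M`.) -/
noncomputable def deformedAct (M : StrongHopfModule h S) : M.X ⊗ B ⟶ M.X :=
  if D : Nonempty M.Comparison then D.some.deformed else M.act

/-- Morphisms of strong Hopf modules: `H`-colinear and `B`-quasilinear morphisms. -/
@[ext]
structure Hom (M Q : StrongHopfModule h S) where
  hom : M.X ⟶ Q.X
  colinear : M.coact ≫ hom ▷ H = hom ≫ Q.coact
  quasilinear : hom ▷ B ≫ Q.deformedAct = M.deformedAct ≫ hom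

/-- The category of strong `(H, B, h)`-Hopf modules. -/
instance : Category (StrongHopfModule h S) where
  Hom M Q := Hom M Q
  id M := ⟨𝟙 M.X, by simp, by simp⟩
  comp f g := ⟨f.hom ≫ g.hom,
    by rw [comp_whiskerRight, ← Category.assoc, f.colinear, Category.assoc, g.colinear,
      Category.assoc],
    by rw [comp_whiskerRight, Category.assoc, g.quasilinear, ← Category.assoc, f.quasilinear,
      Category.assoc]⟩

end StrongHopfModule

variable {h : H ⟶ B} {S : BCoinv h}

/-- `F` is an induction functor `- ⊗_{B^{co H}} B`: it comes with coequalizers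
`n_N : N ⊗ B ⟶ N ⊗_{B^{co H}} B = F N`, the action and coaction of `F N` are the induced ones, and
`F f = f ⊗_{B^{co H}} B` is the morphism induced by `f ⊗ B`. -/
structure InductionFunctor [MonObj S.obj]
    (F : RightModule S.obj ⥤ StrongHopfModule h S) where
  n (N : RightModule S.obj) : N.X ⊗ B ⟶ (F.obj N).X
  isBalancedTensor (N : RightModule S.obj) : IsBalancedTensor S N.act (n N)
  induced (N : RightModule S.obj) : IsInducedStructure (n N) (F.obj N).act (F.obj N).coact
  map {N P : RightModule S.obj} (f : N ⟶ P) :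
    n N ≫ (F.map f).hom = f.hom ▷ B ≫ n P

/-- `G` is a functor of coinvariants `M ↦ M^{co H}`: the object underlying `G M` is an image of
`q_M`, with the action `p_M ∘ φ ∘ (i_M ⊗ i_B)`, and `G g = g^{co H}` is the morphism with
`i_Q ∘ g^{co H} = g ∘ i_M`. -/
structure CoinvariantsFunctor [MonObj S.obj]
    (G : StrongHopfModule h S ⥤ RightModule S.obj) where
  i (M : StrongHopfModule h S) : (G.obj M).X ⟶ M.X
  p (M : StrongHopfModule h S) : M.X ⟶ (G.obj M).X
  p_i (M : StrongHopfModule h S) : p M ≫ i M = M.q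
  i_p (M : StrongHopfModule h S) : i M ≫ p M = 𝟙 (G.obj M).X
  act (M : StrongHopfModule h S) : (G.obj M).act = (i M ⊗ₘ S.i) ≫ M.act ≫ p M
  map {M Q : StrongHopfModule h S} (g : M ⟶ Q) : (G.map g).hom ≫ i Q = i M ≫ g.hom

end

end WeakDoiHopf

set_option linter.unusedSectionVars false

/-! Notation is Sweedler's, for generalized elements, with crossings suppressed. The key is a
description of coinvariants that involves neither the action nor the anchor: `m` is fixed by `q`
exactly when `m₀ ⊗ Π̄(m₁) = m₀ ⊗ m₁`, where `Π̄(x) = ε(x 1₁) 1₂` is `rbar` (`comp_coinvEndo_iff`).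

That `q(m)` satisfies this criterion follows from `ρ(q(m)) = m₀ h(λ(m₂)) ⊗ Π^L(m₁)`
(`coinvEndo_coact`), because `Π̄` fixes the image of `Π^L`. No anticomultiplicativity of the
antipode is needed: the formula comes from the two decompositions `q(m₀) h(m₁) = m` and `q(m₀)
h(Π^L(m₁)) = q(m)`. Conversely, the identity `Π̄(x) y = ε(x y₁) y₂` shows that an `m` satisfying the
criterion has `ρ(m b) = m b₀ ⊗ b₁`. Putting `b = 1` gives `ρ(m) = m h(1₁) ⊗ 1₂`, and then `λ = λ ∗
Π^L` turns `q(m)` into `m₀ h(Π^R(m₁)) = m`. Together the two directions make `q` idempotent.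

The comparison morphism `m ⊗ b ↦ m b` has inverse `m ↦ p(m₀) ⊗ h(m₁)`. One composite is the
decomposition of `m`; the other needs `p(m b) = m p(b)` for coinvariant `m` (`act_p`). Actions are
not associative, so `b` is written as `q(b₀) h(b₁)` and brackets are moved only around a coinvariant
factor. The transported action is `m ⊗ b ↦ q(m₀) (h(m₁) b)` (`twistedAct`), which is visibly free of
choices. It agrees with the given action on coinvariants of any strong Hopf module, and everywhere
on induced modules.

Colinear morphisms preserve coinvariants because the criterion only sees the coaction. The counit of
the adjunction is the comparison isomorphism; the inverse of the unit is induced by `n ⊗ b ↦ n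
p(b)`. -/

namespace WeakDoiHopf

/-! ### Morphisms on the last strands of a left-bracketed tensor product -/

section Strands

variable {C : Type u} [Category.{v} C] [MonoidalCategory C]

/-- Apply `m : A ⊗ D ⟶ E` to the last two factors. -/
def join (X : C) {A D E : C} (m : A ⊗ D ⟶ E) : (X ⊗ A) ⊗ D ⟶ X ⊗ E :=
  (α_ X A D).hom ≫ X ◁ m

/-- Apply `d : A ⟶ D ⊗ E` to the last factor. -/
def split (X : C) {A D E : C} (d : A ⟶ D ⊗ E) : X ⊗ A ⟶ (X ⊗ D) ⊗ E :=
  X ◁ d ≫ (α_ X D E).inv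

/-- Create a last factor by `u : 𝟙_ C ⟶ A`. -/
def create (X : C) {A : C} (u : 𝟙_ C ⟶ A) : X ⟶ X ⊗ A :=
  (ρ_ X).inv ≫ X ◁ u

/-- Erase the last factor by `e : A ⟶ 𝟙_ C`. -/
def erase (X : C) {A : C} (e : A ⟶ 𝟙_ C) : X ⊗ A ⟶ X :=
  X ◁ e ≫ (ρ_ X).hom

/-- The interchange law: all strands to the left are collected in `X`, so string-diagram moves
become rewriting steps without visible associators. -/
theorem join_nat {X Y A D E : C} (f : X ⟶ Y) (m : A ⊗ D ⟶ E) :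
    f ▷ A ▷ D ≫ join Y m = join X m ≫ f ▷ E := by
  simp [join, whisker_exchange]

theorem join_nat_assoc {X Y A D E Z : C} (f : X ⟶ Y) (m : A ⊗ D ⟶ E) (k : Y ⊗ E ⟶ Z) :
    f ▷ A ▷ D ≫ join Y m ≫ k = join X m ≫ f ▷ E ≫ k := by
  simp only [← Category.assoc, join_nat]

theorem split_nat {X Y A D E : C} (f : X ⟶ Y) (d : A ⟶ D ⊗ E) :
    f ▷ A ≫ split Y d = split X d ≫ f ▷ D ▷ E := by
  simp [split, ← whisker_exchange_assoc]

theorem split_nat_assoc {X Y A D E Z : C} (f : X ⟶ Y) (d : A ⟶ D ⊗ E)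
    (k : (Y ⊗ D) ⊗ E ⟶ Z) :
    f ▷ A ≫ split Y d ≫ k = split X d ≫ f ▷ D ▷ E ≫ k := by
  simp only [← Category.assoc, split_nat]

theorem create_nat {X Y A : C} (f : X ⟶ Y) (u : 𝟙_ C ⟶ A) :
    f ≫ create Y u = create X u ≫ f ▷ A := by
  simp [create, whisker_exchange]

theorem create_nat_assoc {X Y A Z : C} (f : X ⟶ Y) (u : 𝟙_ C ⟶ A) (k : Y ⊗ A ⟶ Z) :
    f ≫ create Y u ≫ k = create X u ≫ f ▷ A ≫ k := by
  simp only [← Category.assoc, create_nat]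

theorem erase_nat {X Y A : C} (f : X ⟶ Y) (e : A ⟶ 𝟙_ C) :
    f ▷ A ≫ erase Y e = erase X e ≫ f := by
  simp [erase, ← whisker_exchange_assoc]

variable [BraidedCategory C]

/-- The braiding of the last two factors. -/
def cross (X A D : C) : (X ⊗ A) ⊗ D ⟶ (X ⊗ D) ⊗ A :=
  (α_ X A D).hom ≫ X ◁ (β_ A D).hom ≫ (α_ X D A).inv

/-- The inverse braiding of the last two factors. -/
def uncross (X A D : C) : (X ⊗ A) ⊗ D ⟶ (X ⊗ D) ⊗ A :=
  (α_ X A D).hom ≫ X ◁ (β_ D A).inv ≫ (α_ X D A).inv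

theorem cross_nat {X Y : C} (f : X ⟶ Y) (A D : C) :
    f ▷ A ▷ D ≫ cross Y A D = cross X A D ≫ f ▷ D ▷ A := by
  simp only [cross, Category.assoc, associator_naturality_left_assoc,
    associator_inv_naturality_left, ← whisker_exchange_assoc]

theorem cross_nat_assoc {X Y Z : C} (f : X ⟶ Y) (A D : C) (k : (Y ⊗ D) ⊗ A ⟶ Z) :
    f ▷ A ▷ D ≫ cross Y A D ≫ k = cross X A D ≫ f ▷ D ▷ A ≫ k := by
  simp only [← Category.assoc, cross_nat]

theorem uncross_nat {X Y : C} (f : X ⟶ Y) (A D : C) :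
    f ▷ A ▷ D ≫ uncross Y A D = uncross X A D ≫ f ▷ D ▷ A := by
  simp only [uncross, Category.assoc, associator_naturality_left_assoc,
    associator_inv_naturality_left, ← whisker_exchange_assoc]

theorem uncross_cross (X A D : C) : uncross X A D ≫ cross X D A = 𝟙 _ := by
  simp [cross, uncross]

theorem cross_left (X : C) {A A' : C} (f : A ⟶ A') (D : C) :
    (X ◁ f) ▷ D ≫ cross X A' D = cross X A D ≫ (X ⊗ D) ◁ f := by
  have e : X ◁ f ▷ D ≫ X ◁ (β_ A' D).hom = X ◁ (β_ A D).hom ≫ X ◁ D ◁ f := by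
    rw [← whiskerLeft_comp, BraidedCategory.braiding_naturality_left, whiskerLeft_comp]
  simp [cross, reassoc_of% e]

theorem cross_right (X A : C) {D D' : C} (f : D ⟶ D') :
    (X ⊗ A) ◁ f ≫ cross X A D' = cross X A D ≫ (X ◁ f) ▷ A := by
  have e : X ◁ A ◁ f ≫ X ◁ (β_ A D').hom = X ◁ (β_ A D).hom ≫ X ◁ f ▷ A := by
    rw [← whiskerLeft_comp, BraidedCategory.braiding_naturality_right, whiskerLeft_comp]
  simp [cross, reassoc_of% e]

theorem cross_join_left (X : C) {A D E : C} (m : A ⊗ D ⟶ E) (Z : C) :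
    join X m ▷ Z ≫ cross X E Z =
      cross (X ⊗ A) D Z ≫ cross X A Z ▷ D ≫ join (X ⊗ Z) m := by
  have e : X ◁ m ▷ Z ≫ X ◁ (β_ E Z).hom = X ◁ (β_ (A ⊗ D) Z).hom ≫ X ◁ Z ◁ m := by
    rw [← whiskerLeft_comp, BraidedCategory.braiding_naturality_left, whiskerLeft_comp]
  rw [BraidedCategory.braiding_tensor_left_hom] at e
  simp [cross, join, reassoc_of% e]

theorem cross_join_right (X Z : C) {A D E : C} (m : A ⊗ D ⟶ E) :
    join (X ⊗ Z) m ≫ cross X Z E =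
      cross X Z A ▷ D ≫ cross (X ⊗ A) Z D ≫ join X m ▷ Z := by
  have e : X ◁ Z ◁ m ≫ X ◁ (β_ Z E).hom = X ◁ (β_ Z (A ⊗ D)).hom ≫ X ◁ m ▷ Z := by
    rw [← whiskerLeft_comp, BraidedCategory.braiding_naturality_right, whiskerLeft_comp]
  rw [BraidedCategory.braiding_tensor_right_hom] at e
  simp [cross, join, reassoc_of% e]

theorem cross_split_left (X : C) {A D E : C} (d : A ⟶ D ⊗ E) (Z : C) :
    split X d ▷ Z ≫ cross (X ⊗ D) E Z ≫ cross X D Z ▷ E =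
      cross X A Z ≫ split (X ⊗ Z) d := by
  have e : X ◁ d ▷ Z ≫ X ◁ (β_ (D ⊗ E) Z).hom = X ◁ (β_ A Z).hom ≫ X ◁ Z ◁ d := by
    rw [← whiskerLeft_comp, BraidedCategory.braiding_naturality_left, whiskerLeft_comp]
  rw [BraidedCategory.braiding_tensor_left_hom] at e
  simp only [whiskerLeft_comp] at e
  have e' := e =≫ X ◁ (α_ Z D E).inv
  simp only [Category.assoc, ← whiskerLeft_comp, Iso.hom_inv_id, Category.comp_id] at e'
  simp only [whiskerLeft_comp] at e'
  simp [cross, split, reassoc_of% e']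

theorem cross_split_right (X Z : C) {A D E : C} (d : A ⟶ D ⊗ E) :
    split (X ⊗ Z) d ≫ cross X Z D ▷ E ≫ cross (X ⊗ D) Z E =
      cross X Z A ≫ split X d ▷ Z := by
  have e : X ◁ Z ◁ d ≫ X ◁ (β_ Z (D ⊗ E)).hom = X ◁ (β_ Z A).hom ≫ X ◁ d ▷ Z := by
    rw [← whiskerLeft_comp, BraidedCategory.braiding_naturality_right, whiskerLeft_comp]
  rw [BraidedCategory.braiding_tensor_right_hom] at e
  simp [cross, split, ← reassoc_of% e]

theorem cross_create_left (X : C) {A : C} (u : 𝟙_ C ⟶ A) (Z : C) :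
    create X u ▷ Z ≫ cross X A Z = create (X ⊗ Z) u := by
  have e : X ◁ u ▷ Z ≫ X ◁ (β_ A Z).hom = X ◁ (β_ (𝟙_ C) Z).hom ≫ X ◁ Z ◁ u := by
    rw [← whiskerLeft_comp, BraidedCategory.braiding_naturality_left, whiskerLeft_comp]
  simp [cross, create, reassoc_of% e]

theorem cross_erase_left (X : C) {A : C} (e : A ⟶ 𝟙_ C) (Z : C) :
    cross X A Z ≫ erase (X ⊗ Z) e = erase X e ▷ Z := by
  have e : X ◁ e ▷ Z ≫ X ◁ (β_ (𝟙_ C) Z).hom = X ◁ (β_ A Z).hom ≫ X ◁ Z ◁ e := by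
    rw [← whiskerLeft_comp, BraidedCategory.braiding_naturality_left, whiskerLeft_comp]
  simp [cross, erase, ← reassoc_of% e]

theorem cross_erase_right (X Z : C) {A : C} (e : A ⟶ 𝟙_ C) :
    cross X Z A ≫ erase X e ▷ Z = erase (X ⊗ Z) e := by
  have e : X ◁ Z ◁ e ≫ X ◁ (β_ Z (𝟙_ C)).hom = X ◁ (β_ Z A).hom ≫ X ◁ e ▷ Z := by
    rw [← whiskerLeft_comp, BraidedCategory.braiding_naturality_right, whiskerLeft_comp]
  simp [cross, erase, ← reassoc_of% e]

end Strands

/-! ### Axioms of weak Hopf quasigroups in strand form -/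

section HopfStrands

variable {C : Type u} [Category.{v} C] [MonoidalCategory C]

section Magma

variable {A : C} [UnitalMagma A]

theorem create_join (X : C) : create (X ⊗ A) uη[A] ≫ join X uμ[A] = 𝟙 _ := by
  have e := congrArg (fun f => X ◁ f) (UnitalMagma.mul_unit (A := A))
  simp only [whiskerLeft_comp] at e
  simp [create, join, e]

theorem create_join_left (X : C) : create X uη[A] ▷ A ≫ join X uμ[A] = 𝟙 _ := by
  have e := congrArg (fun f => X ◁ f) (UnitalMagma.unit_mul (A := A))
  simp only [whiskerLeft_comp] at e
  simp [create, join, e]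

end Magma

section Comonoid

variable {H : C} [ComonObj H]

theorem split_erase (X : C) : split X Δ[H] ≫ erase (X ⊗ H) ε[H] = 𝟙 _ := by
  have e := congrArg (fun f => X ◁ f) (ComonObj.comul_counit H)
  simp only [whiskerLeft_comp] at e
  simp [erase, split, reassoc_of% e]

theorem split_erase_left (X : C) : split X Δ[H] ≫ erase X ε[H] ▷ H = 𝟙 _ := by
  have e := congrArg (fun f => X ◁ f) (ComonObj.counit_comul H)
  simp only [whiskerLeft_comp] at e
  simp [erase, split, reassoc_of% e]

theorem split_split (X : C) :
    split X Δ[H] ≫ split (X ⊗ H) Δ[H] = split X Δ[H] ≫ split X Δ[H] ▷ H := by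
  have e := congrArg (fun f => X ◁ f) (ComonObj.comul_assoc H)
  simp only [whiskerLeft_comp] at e
  simp [split, reassoc_of% e]

end Comonoid

variable (H : C) [UnitalMagma H] [ComonObj H]

/-- Multiply the last two factors and apply the counit. -/
def pair (X : C) : (X ⊗ H) ⊗ H ⟶ X :=
  join X uμ[H] ≫ erase X ε[H]

/-- Create the coproduct of the unit as the last two factors. -/
def cup (X : C) : X ⟶ (X ⊗ H) ⊗ H :=
  create X uη[H] ≫ split X Δ[H]

variable {H}

theorem pair_nat {X Y : C} (f : X ⟶ Y) : f ▷ H ▷ H ≫ pair H Y = pair H X ≫ f := by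
  simp only [pair, join_nat_assoc, erase_nat, Category.assoc]

theorem pair_nat_assoc {X Y Z : C} (f : X ⟶ Y) (k : Y ⟶ Z) :
    f ▷ H ▷ H ≫ pair H Y ≫ k = pair H X ≫ f ≫ k := by
  simp only [← Category.assoc, pair_nat]

theorem cup_nat {X Y : C} (f : X ⟶ Y) : f ≫ cup H Y = cup H X ≫ f ▷ H ▷ H := by
  simp only [cup, create_nat_assoc, split_nat, Category.assoc]

theorem cup_nat_assoc {X Y Z : C} (f : X ⟶ Y) (k : (Y ⊗ H) ⊗ H ⟶ Z) :
    f ≫ cup H Y ≫ k = cup H X ≫ f ▷ H ▷ H ≫ k := by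
  simp only [← Category.assoc, cup_nat]

theorem cup_split (X : C) :
    cup H X ≫ split (X ⊗ H) Δ[H] = cup H X ≫ split X Δ[H] ▷ H := by
  simp only [cup, Category.assoc, split_split]

theorem conv_eq (X : C) (f g : H ⟶ H) :
    X ◁ conv f g = split X Δ[H] ≫ (X ◁ f) ▷ H ≫ (X ⊗ H) ◁ g ≫ join X uμ[H] := by
  simp [conv, split, join, MonoidalCategory.tensorHom_def]

section Braided

variable [BraidedCategory C]

theorem pair_cross_left (X Z : C) :
    pair H X ▷ Z = cross (X ⊗ H) H Z ≫ cross X H Z ▷ H ≫ pair H (X ⊗ Z) := by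
  simp only [pair, comp_whiskerRight, ← cross_erase_left, ← Category.assoc, cross_join_left]

theorem pair_cross_right (X Z : C) :
    pair H (X ⊗ Z) = cross X Z H ▷ H ≫ cross (X ⊗ H) Z H ≫ pair H X ▷ Z := by
  simp only [pair, comp_whiskerRight, ← cross_erase_right, ← Category.assoc, cross_join_right]

theorem cup_cross_left (X Z : C) :
    cup H X ▷ Z ≫ cross (X ⊗ H) H Z ≫ cross X H Z ▷ H = cup H (X ⊗ Z) := by
  simp only [cup, comp_whiskerRight, Category.assoc, cross_split_left]
  rw [← Category.assoc, cross_create_left]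

variable [WeakHopfQuasigroup H]

theorem join_split (X : C) :
    join X uμ[H] ≫ split X Δ[H] =
      split X Δ[H] ▷ H ≫ split ((X ⊗ H) ⊗ H) Δ[H] ≫ cross (X ⊗ H) H H ▷ H ≫
        join X uμ[H] ▷ H ▷ H ≫ join (X ⊗ H) uμ[H] := by
  have e := congrArg (fun f => X ◁ f) (WeakHopfQuasigroup.mul_comul (H := H))
  simp only [whiskerLeft_comp] at e
  simp only [join, split, Category.assoc, reassoc_of% e]
  simp only [tensorμ, cross, MonoidalCategory.tensorHom_def]
  monoidal

theorem join_pair (X : C) :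
    join X uμ[H] ▷ H ≫ pair H X = join (X ⊗ H) uμ[H] ≫ pair H X := by
  have e := congrArg (fun f => (α_ X (H ⊗ H) H).hom ≫ X ◁ f ≫ (ρ_ X).hom)
    (WeakHopfQuasigroup.counit_mul_mul (H := H))
  simp [join, pair, erase] at e ⊢
  simp [e]

theorem join_pair_split (X : C) :
    join X uμ[H] ▷ H ≫ pair H X =
      split (X ⊗ H) Δ[H] ▷ H ≫ pair H X ▷ H ▷ H ≫ pair H X := by
  have e := congrArg (fun f => (α_ X H H).hom ▷ H ≫ (α_ X (H ⊗ H) H).hom ≫ X ◁ f ≫ (ρ_ X).hom)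
    (WeakHopfQuasigroup.counit_mul_mul_comul (H := H))
  trans (α_ X H H).hom ▷ H ≫ (α_ X (H ⊗ H) H).hom ≫ X ◁ (uμ[H] ▷ H ≫ uμ[H] ≫ ε[H]) ≫ (ρ_ X).hom
  · simp [join, pair, erase]
  · refine e.trans ?_
    simp only [join, pair, erase, split, MonoidalCategory.tensorHom_def]
    monoidal

theorem join_pair_uncross (X : C) :
    join X uμ[H] ▷ H ≫ pair H X =
      split (X ⊗ H) Δ[H] ▷ H ≫ uncross (X ⊗ H) H H ▷ H ≫ pair H X ▷ H ▷ H ≫ pair H X := by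
  have e := congrArg (fun f => (α_ X H H).hom ▷ H ≫ (α_ X (H ⊗ H) H).hom ≫ X ◁ f ≫ (ρ_ X).hom)
    (WeakHopfQuasigroup.counit_mul_mul_braid (H := H))
  trans (α_ X H H).hom ▷ H ≫ (α_ X (H ⊗ H) H).hom ≫ X ◁ (uμ[H] ▷ H ≫ uμ[H] ≫ ε[H]) ≫ (ρ_ X).hom
  · simp [join, pair, erase]
  · refine e.trans ?_
    simp only [join, pair, erase, split, uncross, MonoidalCategory.tensorHom_def]
    monoidal

theorem cup_split_left (X : C) :
    cup H X ≫ split X Δ[H] ▷ H =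
      cup H X ≫ cup H ((X ⊗ H) ⊗ H) ≫ join (X ⊗ H) uμ[H] ▷ H := by
  have e := congrArg (fun f => (ρ_ X).inv ≫ X ◁ f ≫ (α_ X (H ⊗ H) H).inv ≫ (α_ X H H).inv ▷ H)
    (WeakHopfQuasigroup.comul_comul_unit (H := H))
  trans (ρ_ X).inv ≫ X ◁ (uη[H] ≫ Δ[H] ≫ Δ[H] ▷ H) ≫ (α_ X (H ⊗ H) H).inv ≫ (α_ X H H).inv ▷ H
  · simp [cup, create, split]
  · refine e.trans ?_
    simp only [join, cup, create, split, MonoidalCategory.tensorHom_def]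
    monoidal

theorem cup_split_uncross (X : C) :
    cup H X ≫ split X Δ[H] ▷ H =
      cup H X ≫ cup H ((X ⊗ H) ⊗ H) ≫ uncross (X ⊗ H) H H ▷ H ≫ join (X ⊗ H) uμ[H] ▷ H := by
  have e := congrArg (fun f => (ρ_ X).inv ≫ X ◁ f ≫ (α_ X (H ⊗ H) H).inv ≫ (α_ X H H).inv ▷ H)
    (WeakHopfQuasigroup.comul_comul_unit_braid (H := H))
  trans (ρ_ X).inv ≫ X ◁ (uη[H] ≫ Δ[H] ≫ Δ[H] ▷ H) ≫ (α_ X (H ⊗ H) H).inv ≫ (α_ X H H).inv ▷ H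
  · simp [cup, create, split]
  · refine e.trans ?_
    simp only [join, cup, create, split, uncross, MonoidalCategory.tensorHom_def]
    monoidal

theorem piL_eq (X : C) :
    X ◁ piL H = cup H X ▷ H ≫ cross (X ⊗ H) H H ≫ pair H X ▷ H := by
  rw [piL, antipode, WeakHopfQuasigroup.target_eq]
  simp only [pair, join, erase, cup, create, split, cross]
  monoidal

theorem piR_eq (X : C) :
    X ◁ piR H = cup H (X ⊗ H) ≫ cross X H H ▷ H ≫ pair H (X ⊗ H) := by
  rw [piR, antipode, WeakHopfQuasigroup.source_eq]
  simp only [pair, join, erase, cup, create, split, cross]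
  monoidal

theorem join_split_antipode (X : C) :
    split (X ⊗ H) Δ[H] ≫ join X uμ[H] ▷ H ≫ (X ⊗ H) ◁ antipode H ≫ join X uμ[H] =
      (X ⊗ H) ◁ piL H ≫ join X uμ[H] := by
  have e := congrArg (fun f => (α_ X H H).hom ≫ X ◁ f)
    (WeakHopfQuasigroup.antipode_right (H := H))
  trans (α_ X H H).hom ≫ X ◁ (H ◁ conv (𝟙 H) WeakHopfQuasigroup.antipode ≫ uμ[H])
  · refine Eq.trans ?_ e
    simp only [join, split, antipode, MonoidalCategory.tensorHom_def]
    monoidal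
  · simp [join, piL, antipode]

end Braided

end HopfStrands

/-! ### Naturality of the strand operations below further strands -/

section Whiskered

variable {C : Type u} [Category.{v} C] [MonoidalCategory C] [BraidedCategory C]
variable {H : C} [UnitalMagma H] [ComonObj H] {X Y : C} (f : X ⟶ Y)

/-- Source of the variants below; their subscripts count the idle strands on the right. -/
theorem whiskerRight_square {P Q R S : C} {a : P ⟶ Q} {b : Q ⟶ S} {c : P ⟶ R} {d : R ⟶ S}
    (e : a ≫ b = c ≫ d) (Z : C) : a ▷ Z ≫ b ▷ Z = c ▷ Z ≫ d ▷ Z := by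
  simp only [← comp_whiskerRight, e]

theorem whiskerRight_square_assoc {P Q R S : C} {a : P ⟶ Q} {b : Q ⟶ S} {c : P ⟶ R} {d : R ⟶ S}
    (e : a ≫ b = c ≫ d) (Z : C) {K : C} (k : S ⊗ Z ⟶ K) :
    a ▷ Z ≫ b ▷ Z ≫ k = c ▷ Z ≫ d ▷ Z ≫ k := by
  simp only [← comp_whiskerRight_assoc, e]

theorem join_nat₁_assoc {A D E : C} (m : A ⊗ D ⟶ E) (Z : C) {K : C} (k : (Y ⊗ E) ⊗ Z ⟶ K) :
    f ▷ A ▷ D ▷ Z ≫ join Y m ▷ Z ≫ k = join X m ▷ Z ≫ f ▷ E ▷ Z ≫ k :=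
  whiskerRight_square_assoc (join_nat f m) Z k

theorem split_nat₁ {A D E : C} (m : A ⟶ D ⊗ E) (Z : C) :
    f ▷ A ▷ Z ≫ split Y m ▷ Z = split X m ▷ Z ≫ f ▷ D ▷ E ▷ Z :=
  whiskerRight_square (split_nat f m) Z

theorem split_nat₁_assoc {A D E : C} (m : A ⟶ D ⊗ E) (Z : C) {K : C} (k : ((Y ⊗ D) ⊗ E) ⊗ Z ⟶ K) :
    f ▷ A ▷ Z ≫ split Y m ▷ Z ≫ k = split X m ▷ Z ≫ f ▷ D ▷ E ▷ Z ≫ k :=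
  whiskerRight_square_assoc (split_nat f m) Z k

theorem split_nat₂_assoc {A D E : C} (m : A ⟶ D ⊗ E) (Z Z' : C)
    {K : C} (k : (((Y ⊗ D) ⊗ E) ⊗ Z) ⊗ Z' ⟶ K) :
    f ▷ A ▷ Z ▷ Z' ≫ split Y m ▷ Z ▷ Z' ≫ k = split X m ▷ Z ▷ Z' ≫ f ▷ D ▷ E ▷ Z ▷ Z' ≫ k :=
  whiskerRight_square_assoc (split_nat₁ f m Z) Z' k

theorem pair_nat₁ (Z : C) :
    f ▷ H ▷ H ▷ Z ≫ pair H Y ▷ Z = pair H X ▷ Z ≫ f ▷ Z :=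
  whiskerRight_square (pair_nat f) Z

theorem cup_nat₁_assoc (Z : C) {K : C} (k : ((Y ⊗ H) ⊗ H) ⊗ Z ⟶ K) :
    f ▷ Z ≫ cup H Y ▷ Z ≫ k = cup H X ▷ Z ≫ f ▷ H ▷ H ▷ Z ≫ k :=
  whiskerRight_square_assoc (cup_nat f) Z k

theorem cross_nat₁ (A D : C) (Z : C) :
    f ▷ A ▷ D ▷ Z ≫ cross Y A D ▷ Z = cross X A D ▷ Z ≫ f ▷ D ▷ A ▷ Z :=
  whiskerRight_square (cross_nat f A D) Z

theorem cross_nat₁_assoc (A D : C) (Z : C) {K : C} (k : ((Y ⊗ D) ⊗ A) ⊗ Z ⟶ K) :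
    f ▷ A ▷ D ▷ Z ≫ cross Y A D ▷ Z ≫ k = cross X A D ▷ Z ≫ f ▷ D ▷ A ▷ Z ≫ k :=
  whiskerRight_square_assoc (cross_nat f A D) Z k

theorem cross_nat₂_assoc (A D : C) (Z Z' : C) {K : C} (k : (((Y ⊗ D) ⊗ A) ⊗ Z) ⊗ Z' ⟶ K) :
    f ▷ A ▷ D ▷ Z ▷ Z' ≫ cross Y A D ▷ Z ▷ Z' ≫ k = cross X A D ▷ Z ▷ Z' ≫ f ▷ D ▷ A ▷ Z ▷ Z' ≫ k :=
  whiskerRight_square_assoc (cross_nat₁ f A D Z) Z' k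

theorem uncross_nat₁ (A D : C) (Z : C) :
    f ▷ A ▷ D ▷ Z ≫ uncross Y A D ▷ Z = uncross X A D ▷ Z ≫ f ▷ D ▷ A ▷ Z :=
  whiskerRight_square (uncross_nat f A D) Z

theorem uncross_nat₁_assoc (A D : C) (Z : C) {K : C} (k : ((Y ⊗ D) ⊗ A) ⊗ Z ⟶ K) :
    f ▷ A ▷ D ▷ Z ≫ uncross Y A D ▷ Z ≫ k = uncross X A D ▷ Z ≫ f ▷ D ▷ A ▷ Z ≫ k :=
  whiskerRight_square_assoc (uncross_nat f A D) Z k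

theorem uncross_nat₂_assoc (A D : C) (Z Z' : C) {K : C} (k : (((Y ⊗ D) ⊗ A) ⊗ Z) ⊗ Z' ⟶ K) :
    f ▷ A ▷ D ▷ Z ▷ Z' ≫ uncross Y A D ▷ Z ▷ Z' ≫ k =
      uncross X A D ▷ Z ▷ Z' ≫ f ▷ D ▷ A ▷ Z ▷ Z' ≫ k :=
  whiskerRight_square_assoc (uncross_nat₁ f A D Z) Z' k

end Whiskered

/-! ### The morphisms `Π^L` and `Π̄` of a weak Hopf quasigroup -/

section HopfIdentities

variable {C : Type u} [Category.{v} C] [MonoidalCategory C] [BraidedCategory C]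

theorem cross_uncross (X A D : C) : cross X A D ≫ uncross X D A = 𝟙 _ := by
  simp [cross, uncross]

theorem uncross_split (X Z : C) {A D E : C} (d : A ⟶ D ⊗ E) :
    uncross X Z A ≫ split X d ▷ Z =
      split (X ⊗ Z) d ≫ uncross X Z D ▷ E ≫ uncross (X ⊗ D) Z E := by
  have e : uncross X Z A ≫ (split X d ▷ Z ≫ cross (X ⊗ D) E Z ≫ cross X D Z ▷ E) ≫
      uncross X Z D ▷ E ≫ uncross (X ⊗ D) Z E =
      uncross X Z A ≫ (cross X A Z ≫ split (X ⊗ Z) d) ≫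
        uncross X Z D ▷ E ≫ uncross (X ⊗ D) Z E := by
    rw [cross_split_left]
  simp only [Category.assoc] at e
  rw [← comp_whiskerRight_assoc, cross_uncross, id_whiskerRight, Category.id_comp, cross_uncross,
    Category.comp_id, reassoc_of% uncross_cross] at e
  exact e

variable {H : C} [UnitalMagma H] [ComonObj H] 

/-- A strand crossing one leg of a pairing equals the inverse crossing with the other leg;
`cup_cross` is the dual. These produce the inverse braidings of the axioms, without any symmetry of
the braiding. -/
theorem cross_pair (X : C) :
    cross (X ⊗ H) H H ≫ pair H X ▷ H = uncross X H H ▷ H ≫ pair H (X ⊗ H) := by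
  rw [pair_cross_right, ← comp_whiskerRight_assoc, uncross_cross, id_whiskerRight,
    Category.id_comp]

theorem cup_cross (X : C) :
    cup H X ▷ H ≫ cross (X ⊗ H) H H = cup H (X ⊗ H) ≫ uncross X H H ▷ H := by
  rw [← cup_cross_left, Category.assoc, Category.assoc, ← comp_whiskerRight, cross_uncross,
    id_whiskerRight, Category.comp_id]

variable (H) in
/-- `x ↦ ε(x 1₁) 1₂` on the last factor. -/
def rbar (X : C) : X ⊗ H ⟶ X ⊗ H :=
  cup H (X ⊗ H) ≫ pair H X ▷ H

theorem rbar_nat {X Y : C} (f : X ⟶ Y) : f ▷ H ≫ rbar H Y = rbar H X ≫ f ▷ H := by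
  simp only [rbar, Category.assoc, cup_nat_assoc, ← comp_whiskerRight, pair_nat]

theorem rbar_nat_assoc {X Y Z : C} (f : X ⟶ Y) (k : Y ⊗ H ⟶ Z) :
    f ▷ H ≫ rbar H Y ≫ k = rbar H X ≫ f ▷ H ≫ k := by
  simp only [← Category.assoc, rbar_nat]

theorem cross_rbar (X Z : C) :
    cross X H Z ≫ rbar H (X ⊗ Z) = rbar H X ▷ Z ≫ cross X H Z := by
  have e := cup_cross_left (H := H) (X ⊗ H) Z
  calc cross X H Z ≫ rbar H (X ⊗ Z)
      = cup H ((X ⊗ H) ⊗ Z) ≫ cross X H Z ▷ H ▷ H ≫ pair H (X ⊗ Z) ▷ H := by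
        simp only [rbar, cup_nat_assoc]
    _ = cup H (X ⊗ H) ▷ Z ≫ cross ((X ⊗ H) ⊗ H) H Z ≫ (cross (X ⊗ H) H Z ≫
          cross X H Z ▷ H ≫ pair H (X ⊗ Z)) ▷ H := by
        rw [← cup_cross_left]; simp only [comp_whiskerRight, Category.assoc]
    _ = _ := by
        rw [← pair_cross_left, rbar]; simp only [cross_nat, comp_whiskerRight, Category.assoc]

variable [WeakHopfQuasigroup H]

/-- Applying `Π^L` to the last leg creates a second copy of `δη`, linked to the first by an inverse
braiding and a product. The unit axiom contracts the two to the iterated coproduct of `1`, whose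
middle leg meets the counit. `cup_rbar` is the same with the unbraided axiom. -/
theorem cup_piL (X : C) : cup H X ≫ (X ⊗ H) ◁ piL H = cup H X := by
  rw [piL_eq, reassoc_of% (cup_cross (H := H) (X ⊗ H)), pair, comp_whiskerRight]
  have e := cup_split_uncross (H := H) X
  rw [← reassoc_of% e, ← comp_whiskerRight, split_erase, id_whiskerRight, Category.comp_id]

theorem cup_rbar (X : C) : cup H X ≫ rbar H (X ⊗ H) = cup H X := by
  rw [rbar, pair, comp_whiskerRight]
  have e := cup_split_left (H := H) X
  rw [← reassoc_of% e, ← comp_whiskerRight, split_erase, id_whiskerRight, Category.comp_id]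

theorem piL_rbar (X : C) : X ◁ piL H ≫ rbar H X = X ◁ piL H := by
  calc X ◁ piL H ≫ rbar H X
      = cup H X ▷ H ≫ cross (X ⊗ H) H H ≫ rbar H ((X ⊗ H) ⊗ H) ≫ pair H X ▷ H := by
        rw [piL_eq]; simp only [rbar, cup_nat_assoc, comp_whiskerRight, Category.assoc, pair_nat₁]
    _ = (cup H X ≫ rbar H (X ⊗ H)) ▷ H ≫ cross (X ⊗ H) H H ≫ pair H X ▷ H := by
        rw [reassoc_of% (cross_rbar (H := H) (X ⊗ H) H), comp_whiskerRight, Category.assoc]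
    _ = _ := by rw [cup_rbar, piL_eq]

theorem piL_split (X : C) :
    X ◁ piL H ≫ split X Δ[H] =
      (cup H X ≫ split X Δ[H] ▷ H) ▷ H ≫ cross ((X ⊗ H) ⊗ H) H H ≫
        cross (X ⊗ H) H H ▷ H ≫ pair H X ▷ H ▷ H := by
  have e := cross_split_left (X ⊗ H) Δ[H] H
  rw [← cup_split, piL_eq, Category.assoc, Category.assoc, split_nat, ← reassoc_of% e,
    comp_whiskerRight, Category.assoc]

/-- The coproduct of `Π^L(x)` is `ε(1₁ x) 1₂ ⊗ 1₃`, and `Π^L` fixes the last leg of `δ(1)`. -/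
theorem piL_split_piL (X : C) :
    X ◁ piL H ≫ split X Δ[H] ≫ (X ⊗ H) ◁ piL H = X ◁ piL H ≫ split X Δ[H] := by
  have e : (cup H X ≫ split X Δ[H] ▷ H) ≫ ((X ⊗ H) ⊗ H) ◁ piL H =
      cup H X ≫ split X Δ[H] ▷ H := by
    rw [Category.assoc, ← whisker_exchange, reassoc_of% (cup_piL (H := H) X)]
  rw [reassoc_of% (piL_split (H := H) X), ← whisker_exchange, ← whisker_exchange_assoc,
    ← reassoc_of% (cross_left ((X ⊗ H) ⊗ H) (piL H) H), ← comp_whiskerRight_assoc, e, piL_split]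

/-- The counit on the first leg of `δ(xy)`. As `ε` is not multiplicative, the factor `ε(x₁ y₁)`
remains. Together with the two unit insertions that follow, this brings an expression into a shape
where the weak axioms apply. -/
theorem join_eq (X : C) :
    join X uμ[H] = split X Δ[H] ▷ H ≫ split ((X ⊗ H) ⊗ H) Δ[H] ≫ cross (X ⊗ H) H H ▷ H ≫
      pair H X ▷ H ▷ H ≫ join X uμ[H] := by
  have e := join_split (H := H) X =≫ erase X ε[H] ▷ H
  simp only [Category.assoc, split_erase_left, Category.comp_id] at e
  nth_rewrite 1 [e]
  simp only [pair, join_nat, join_nat_assoc, split_nat_assoc, comp_whiskerRight, Category.assoc]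

theorem split_eq (X : C) :
    split X Δ[H] = split X Δ[H] ≫ cup H ((X ⊗ H) ⊗ H) ≫ cross (X ⊗ H) H H ▷ H ≫
      join X uμ[H] ▷ H ▷ H ≫ join (X ⊗ H) uμ[H] := by
  have e := create (X ⊗ H) uη[H] ≫= join_split (H := H) X
  rw [reassoc_of% (create_join (A := H) X)] at e
  nth_rewrite 1 [e]
  simp only [cup, join_nat, split_nat_assoc, create_nat_assoc, Category.assoc]

theorem split_eq_left (X : C) :
    split X Δ[H] = cup H X ▷ H ≫ split ((X ⊗ H) ⊗ H) Δ[H] ≫ cross (X ⊗ H) H H ▷ H ≫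
      join X uμ[H] ▷ H ▷ H ≫ join (X ⊗ H) uμ[H] := by
  have e := create X uη[H] ▷ H ≫= join_split (H := H) X
  rw [reassoc_of% (create_join_left (A := H) X)] at e
  nth_rewrite 1 [e]
  simp only [cup, join_nat, split_nat_assoc, comp_whiskerRight, Category.assoc]

/-- Insert `1` to the left of `y`: then `ε(x y₁) y₂ = ε(x (1₁ y₁)) (1₂ y₂)`, and the counit axioms
split the scalar as `ε(x 1₁) ε(1₂ y₁)`, leaving `1₃ y₂`. By `join_eq` the result is `Π̄(x) y`. -/
theorem rbar_join (X : C) :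
    rbar H X ▷ H ≫ join X uμ[H] = split (X ⊗ H) Δ[H] ≫ pair H X ▷ H := by
  symm
  calc split (X ⊗ H) Δ[H] ≫ pair H X ▷ H
      = cup H (X ⊗ H) ▷ H ≫ split (((X ⊗ H) ⊗ H) ⊗ H) Δ[H] ≫ cross ((X ⊗ H) ⊗ H) H H ▷ H ≫
          (join (X ⊗ H) uμ[H] ≫ pair H X) ▷ H ▷ H ≫ join X uμ[H] := by
        rw [split_eq_left]; simp only [join_nat, join_nat_assoc, split_nat_assoc,
          comp_whiskerRight, Category.assoc]
    _ = (cup H (X ⊗ H) ≫ split (X ⊗ H) Δ[H] ▷ H) ▷ H ≫ split ((((X ⊗ H) ⊗ H) ⊗ H) ⊗ H) Δ[H] ≫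
          cross (((X ⊗ H) ⊗ H) ⊗ H) H H ▷ H ≫ pair H X ▷ H ▷ H ▷ H ▷ H ≫ pair H X ▷ H ▷ H ≫
            join X uμ[H] := by
        rw [← join_pair, join_pair_split]; simp only [join_nat, join_nat_assoc, split_nat_assoc,
          pair_nat, comp_whiskerRight, Category.assoc, pair_nat₁, cross_nat₁_assoc]
    _ = _ := by
        rw [← cup_split]
        conv_rhs => rw [join_eq]
        simp only [rbar, join_nat, join_nat_assoc, split_nat_assoc, comp_whiskerRight,
          Category.assoc, split_nat₂_assoc, pair_nat₁, cross_nat₁_assoc]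

/-- The identity `x Π^L(y) = ε(x₁ y) x₂`, a substitute for associativity. It uses the counit axiom
with inverse braiding. -/
theorem piL_join (X : C) :
    (X ⊗ H) ◁ piL H ≫ join X uμ[H] =
      split X Δ[H] ▷ H ≫ cross (X ⊗ H) H H ≫ pair H X ▷ H := by
  have es : ∀ Y : C, split Y (Δ[H] ≫ (β_ H H).inv) = split Y Δ[H] ≫ uncross Y H H := by
    intro Y; simp [split, uncross]
  have key : ∀ Y : C, cup H Y ≫ uncross Y H H ≫ split Y Δ[H] ▷ H =
      cup H Y ≫ split Y Δ[H] ▷ H ≫ uncross Y H H ▷ H ≫ uncross (Y ⊗ H) H H := by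
    intro Y
    rw [uncross_split, reassoc_of% (cup_split (H := H) Y)]
  -- Both sides reduce to `ε(x₁ 1₂) ε(1₁ y) x₂ 1₃`.
  trans split X Δ[H] ▷ H ≫ (cup H ((X ⊗ H) ⊗ H) ≫ uncross ((X ⊗ H) ⊗ H) H H ≫
      split ((X ⊗ H) ⊗ H) Δ[H] ▷ H) ▷ H ≫ cross (X ⊗ H) H H ▷ H ▷ H ▷ H ≫
      pair H X ▷ H ▷ H ▷ H ▷ H ≫ pair H ((X ⊗ H) ⊗ H) ≫ join X uμ[H]
  · rw [piL_eq, Category.assoc, Category.assoc, reassoc_of% (cross_pair (H := H) (X ⊗ H))]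
    nth_rewrite 1 [join_eq]
    simp only [join_nat, split_nat_assoc, pair_nat_assoc, comp_whiskerRight, Category.assoc,
      cup_nat₁_assoc, uncross_nat₁_assoc]
  · rw [key]
    symm
    have ed := cross_split_right (X ⊗ H) H (Δ[H] ≫ (β_ H H).inv)
    calc split X Δ[H] ▷ H ≫ cross (X ⊗ H) H H ≫ pair H X ▷ H
        = split X Δ[H] ▷ H ≫ cup H ((X ⊗ H) ⊗ H) ▷ H ≫ cross (X ⊗ H) H H ▷ H ▷ H ≫
            cross (((X ⊗ H) ⊗ H) ⊗ H) H H ≫ cross ((X ⊗ H) ⊗ H) H H ▷ H ≫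
            (join X uμ[H] ▷ H ≫ pair H X) ▷ H ▷ H ≫ join X uμ[H] := by
          nth_rewrite 1 [split_eq]
          have e := cross_join_left (X ⊗ H) uμ[H] H
          simp only [comp_whiskerRight, Category.assoc, reassoc_of% e]
          simp only [join_nat, join_nat_assoc, cross_nat_assoc, cup_nat₁_assoc, cross_nat₁_assoc]
      _ = split X Δ[H] ▷ H ≫ cup H ((X ⊗ H) ⊗ H) ▷ H ≫
            (cross (X ⊗ H) H H ≫ split (X ⊗ H) (Δ[H] ≫ (β_ H H).inv) ▷ H) ▷ H ▷ H ≫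
            cross ((((X ⊗ H) ⊗ H) ⊗ H) ⊗ H) H H ≫ cross (((X ⊗ H) ⊗ H) ⊗ H) H H ▷ H ≫
            pair H X ▷ H ▷ H ▷ H ▷ H ≫ pair H X ▷ H ▷ H ≫ join X uμ[H] := by
          rw [join_pair_uncross, es]; simp only [join_nat, join_nat_assoc, cross_nat_assoc,
            pair_nat, comp_whiskerRight, Category.assoc, pair_nat₁, cup_nat₁_assoc,
            cross_nat₁_assoc]
      _ = split X Δ[H] ▷ H ≫ cup H ((X ⊗ H) ⊗ H) ▷ H ≫
            split ((X ⊗ H) ⊗ H) (Δ[H] ≫ (β_ H H).inv) ▷ H ▷ H ≫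
            cross (X ⊗ H) H H ▷ H ▷ H ▷ H ≫ pair H X ▷ H ▷ H ▷ H ▷ H ≫
            cross ((X ⊗ H) ⊗ H) H H ≫ (cross X H H ▷ H ≫ cross (X ⊗ H) H H ≫
              pair H X ▷ H) ▷ H ≫ join X uμ[H] := by
          rw [← ed]; simp only [join_nat, join_nat_assoc, cross_nat_assoc, comp_whiskerRight,
            Category.assoc, split_nat₂_assoc, pair_nat₁, cup_nat₁_assoc, cross_nat₁_assoc,
            cross_nat₂_assoc]
      _ = split X Δ[H] ▷ H ≫ cup H ((X ⊗ H) ⊗ H) ▷ H ≫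
            split ((X ⊗ H) ⊗ H) (Δ[H] ≫ (β_ H H).inv) ▷ H ▷ H ≫
            cross (X ⊗ H) H H ▷ H ▷ H ▷ H ≫ pair H X ▷ H ▷ H ▷ H ▷ H ≫
            uncross (X ⊗ H) H H ▷ H ≫ pair H ((X ⊗ H) ⊗ H) ≫ join X uμ[H] := by
          rw [← pair_cross_right, reassoc_of% (cross_pair (H := H) (X ⊗ H))]
      _ = _ := by
          rw [es]; simp only [join_nat, pair_nat_assoc, comp_whiskerRight, Category.assoc,
            split_nat₂_assoc, cup_nat₁_assoc, uncross_nat₁_assoc, uncross_nat₂_assoc]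

end HopfIdentities

/-! ### The endomorphism `q` and its fixed elements -/

section PreHopfModule

variable {C : Type u} [Category.{v} C] [MonoidalCategory C] [BraidedCategory C]
variable {H B : C} [UnitalMagma H] [ComonObj H] [WeakHopfQuasigroup H] [UnitalMagma B]
  [ComoduleMagma H B]

/-- The axioms of a strong Hopf module that do not involve the coinvariants of `B`. -/
structure IsPreHopfModule (h : H ⟶ B) {M : C} (act : M ⊗ B ⟶ M) (coact : M ⟶ M ⊗ H) :
    Prop where
  comodule : IsRightComodule H coact
  act_unit : M ◁ uη[B] ≫ act = (ρ_ M).hom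
  act_coact : act ≫ coact = (coact ⊗ₘ coactB H B) ≫ tensorμ M H B H ≫ (act ⊗ₘ uμ[H])
  act_target : M ◁ Δ[H] ⊗≫ ((M ◁ h ≫ act) ⊗ₘ (antipode H ≫ h)) ≫ act =
    M ◁ (piL H ≫ h) ≫ act
  act_source : M ◁ Δ[H] ⊗≫ ((M ◁ (antipode H ≫ h) ≫ act) ⊗ₘ h) ≫ act =
    M ◁ (piR H ≫ h) ≫ act

theorem StrongHopfModule.isPreHopfModule {h : H ⟶ B} {S : BCoinv h} (M : StrongHopfModule h S) :
    IsPreHopfModule h M.act M.coact :=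
  ⟨M.comodule, M.act_unit, M.act_coact, M.act_target, M.act_source⟩

theorem IsAnchor.isPreHopfModule {h : H ⟶ B} (hh : IsAnchor h) :
    IsPreHopfModule h uμ[B] (coactB H B) :=
  ⟨ComoduleMagma.comodule, UnitalMagma.mul_unit, ComoduleMagma.mul_coact.symm,
    hh.mul_target, hh.mul_source⟩

/-- The action of `H` along `h : H ⟶ B`. -/
def hact (h : H ⟶ B) {M : C} (act : M ⊗ B ⟶ M) : M ⊗ H ⟶ M :=
  M ◁ h ≫ act

theorem coinvEndo_eq (h : H ⟶ B) {M : C} (act : M ⊗ B ⟶ M) (coact : M ⟶ M ⊗ H) :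
    coinvEndo h act coact = coact ≫ M ◁ antipode H ≫ hact h act := by
  simp [coinvEndo, hact]

theorem coactB_split (X : C) :
    split X (coactB H B) ≫ split (X ⊗ B) Δ[H] =
      split X (coactB H B) ≫ split X (coactB H B) ▷ H := by
  have e := congrArg (fun f => X ◁ f)
    (ComoduleMagma.comodule (H := H) (B := B)).coassoc
  simp only [whiskerLeft_comp] at e
  simp [split, reassoc_of% e]

namespace IsAnchor

variable {h : H ⟶ B} (hh : IsAnchor h)
include hh

theorem split_coactB (X : C) :
    X ◁ h ≫ split X (coactB H B) = split X Δ[H] ≫ (X ◁ h) ▷ H := by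
  have e := congrArg (fun f => X ◁ f) hh.colinear
  simp only [whiskerLeft_comp] at e
  simp [split, reassoc_of% e]

theorem create_comp (X : C) : create X uη[H] ≫ X ◁ h = create X uη[B] := by
  simp only [create, Category.assoc, ← whiskerLeft_comp, hh.magmaHom.unit]

theorem create_coactB (X : C) :
    create X uη[B] ≫ split X (coactB H B) = cup H X ≫ (X ◁ h) ▷ H := by
  rw [← hh.create_comp, Category.assoc, hh.split_coactB, cup, Category.assoc]

end IsAnchor

namespace IsPreHopfModule

variable {h : H ⟶ B} {M : C} {act : M ⊗ B ⟶ M} {coact : M ⟶ M ⊗ H}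
  (hM : IsPreHopfModule h act coact)
include hM

theorem coact_erase : coact ≫ erase M ε[H] = 𝟙 M := by
  simp [erase, reassoc_of% hM.comodule.counit]

theorem coact_split : coact ≫ split M Δ[H] = coact ≫ coact ▷ H := by
  simp [split, reassoc_of% hM.comodule.coassoc]

theorem create_act : create M uη[B] ≫ act = 𝟙 M := by
  simp [create, hM.act_unit]

theorem act_comp_coact :
    act ≫ coact = coact ▷ B ≫ split (M ⊗ H) (coactB H B) ≫ cross M H B ▷ H ≫ act ▷ H ▷ H ≫
      join M uμ[H] := by
  rw [hM.act_coact]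
  simp only [tensorμ, cross, join, split, MonoidalCategory.tensorHom_def]
  monoidal

/-- The counit applied to the compatibility of action and coaction: `m b = m₀ b₀ ε(m₁ b₁)`. From
right to left it absorbs pairings. -/
theorem act_eq :
    act = coact ▷ B ≫ split (M ⊗ H) (coactB H B) ≫ cross M H B ▷ H ≫ act ▷ H ▷ H ≫
      pair H M := by
  have e := hM.act_comp_coact =≫ erase M ε[H]
  simpa only [pair, Category.assoc, hM.coact_erase, Category.comp_id] using e

theorem hact_target :
    split M Δ[H] ≫ hact h act ▷ H ≫ M ◁ antipode H ≫ hact h act = M ◁ piL H ≫ hact h act := by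
  have e := hM.act_target
  simp only [whiskerLeft_comp, Category.assoc] at e
  simp only [hact]
  rw [← e]
  simp only [split, MonoidalCategory.tensorHom_def]
  monoidal

theorem hact_source :
    split M Δ[H] ≫ (M ◁ antipode H ≫ hact h act) ▷ H ≫ hact h act =
      M ◁ piR H ≫ hact h act := by
  have e := hM.act_source
  simp only [whiskerLeft_comp, Category.assoc] at e
  simp only [hact]
  rw [← e]
  simp only [split, MonoidalCategory.tensorHom_def]
  monoidal

variable (hh : IsAnchor h)
include hh

theorem create_hact : create M uη[H] ≫ hact h act = 𝟙 M := by
  rw [hact, reassoc_of% hh.create_comp, hM.create_act]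

theorem hact_comp_coact :
    hact h act ≫ coact = coact ▷ H ≫ split (M ⊗ H) Δ[H] ≫ cross M H H ▷ H ≫
      hact h act ▷ H ▷ H ≫ join M uμ[H] := by
  have e := cross_right M H h
  rw [hact, Category.assoc, hM.act_comp_coact, whisker_exchange_assoc,
    reassoc_of% (hh.split_coactB (M ⊗ H)), ← comp_whiskerRight_assoc, e]
  simp only [comp_whiskerRight, Category.assoc]

theorem hact_eq :
    hact h act = coact ▷ H ≫ split (M ⊗ H) Δ[H] ≫ cross M H H ▷ H ≫
      hact h act ▷ H ▷ H ≫ pair H M := by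
  have e := hM.hact_comp_coact hh =≫ erase M ε[H]
  simpa only [pair, Category.assoc, hM.coact_erase, Category.comp_id] using e

/-- Expanding `m = m h(1)` by `hact_eq` gives `m₀ h(1₁) ε(m₁ 1₂)`, and `1₁ ε(x 1₂) = Π^R(x)`. -/
theorem coact_source : coact ≫ M ◁ piR H ≫ hact h act = 𝟙 M := by
  rw [← hM.create_hact hh]
  nth_rewrite 2 [hM.hact_eq hh]
  rw [piR_eq]
  simp only [cup, split_nat_assoc, create_nat_assoc, pair_nat, Category.assoc]

/-- By coassociativity `q(m₀) h(m₁)` is `(m₀ h(λ(m₁))) h(m₂)`, which the source axiom turns into `m₀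
h(Π^R(m₁))`. -/
theorem coact_coinvEndo_hact :
    coact ≫ coinvEndo h act coact ▷ H ≫ hact h act = 𝟙 M := by
  have e := hM.coact_split
  rw [← hM.coact_source hh, ← hM.hact_source, reassoc_of% e, coinvEndo_eq]
  simp only [comp_whiskerRight, Category.assoc]

/-- The target axiom gives `q(m₀) h(Π^L(m₁)) = (q(m₀) h(m₁)) h(λ(m₂))`; the inner bracket collapses
by the preceding decomposition. -/
theorem coact_coinvEndo_target :
    coact ≫ coinvEndo h act coact ▷ H ≫ M ◁ piL H ≫ hact h act = coinvEndo h act coact := by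
  have e := hM.coact_split
  rw [← hM.hact_target, split_nat_assoc, reassoc_of% e, ← comp_whiskerRight_assoc,
    ← comp_whiskerRight_assoc, Category.assoc, hM.coact_coinvEndo_hact hh, id_whiskerRight,
    Category.id_comp, ← coinvEndo_eq]

/-- By `piL_join`, `m₁ Π^L(x₂) = ε(m₁ x₂) m₂`, and the scalar is absorbed by `hact_eq`. -/
theorem hact_comp_coact_piL :
    coact ▷ H ≫ split (M ⊗ H) Δ[H] ≫ cross M H H ▷ H ≫ hact h act ▷ H ▷ H ≫
      (M ⊗ H) ◁ piL H ≫ join M uμ[H] = coact ▷ H ≫ cross M H H ≫ hact h act ▷ H := by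
  have e := cross_split_left M Δ[H] H
  have e' := cross_split_right (M ⊗ H) H Δ[H]
  calc _ = coact ▷ H ≫ split (M ⊗ H) Δ[H] ≫ (cross M H H ≫ split (M ⊗ H) Δ[H]) ▷ H ≫
        cross ((M ⊗ H) ⊗ H) H H ≫ hact h act ▷ H ▷ H ▷ H ≫ pair H M ▷ H := by
        rw [piL_join]; simp only [split_nat_assoc, cross_nat_assoc, comp_whiskerRight,
          Category.assoc, split_nat₁_assoc, pair_nat₁]
    _ = (coact ≫ split M Δ[H]) ▷ H ≫ (split ((M ⊗ H) ⊗ H) Δ[H] ≫ cross (M ⊗ H) H H ▷ H ≫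
          cross ((M ⊗ H) ⊗ H) H H) ≫ (cross M H H ▷ H ≫ hact h act ▷ H ▷ H ≫ pair H M) ▷ H := by
        rw [← e]; simp only [split_nat_assoc, cross_nat_assoc, pair_nat, comp_whiskerRight,
          Category.assoc, pair_nat₁]
    _ = coact ▷ H ≫ cross M H H ≫ (coact ▷ H ≫ split (M ⊗ H) Δ[H] ≫ cross M H H ▷ H ≫
          hact h act ▷ H ▷ H ≫ pair H M) ▷ H := by
        rw [e', hM.coact_split]; simp only [split_nat_assoc, cross_nat_assoc, pair_nat,
          comp_whiskerRight, Category.assoc, split_nat₁_assoc]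
    _ = _ := by rw [← hM.hact_eq hh]

/-- Since `Π^L` fixes the second leg of `δ(Π^L(x))`, it may be inserted there for free, and
`hact_comp_coact_piL` applies. -/
theorem piL_hact_coact :
    M ◁ piL H ≫ hact h act ≫ coact =
      coact ▷ H ≫ cross M H H ≫ (M ◁ piL H ≫ hact h act) ▷ H := by
  have e := piL_split_piL (H := H) (M ⊗ H)
  have e' := cross_right M H (piL H)
  have e₁ := hM.hact_comp_coact_piL hh
  rw [hM.hact_comp_coact hh, whisker_exchange_assoc, ← reassoc_of% e]
  calc _ = M ◁ piL H ≫ (coact ▷ H ≫ split (M ⊗ H) Δ[H] ≫ cross M H H ▷ H ≫ hact h act ▷ H ▷ H ≫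
        (M ⊗ H) ◁ piL H ≫ join M uμ[H]) := by simp only [join_nat, split_nat_assoc,
          ← whisker_exchange_assoc]
    _ = _ := by
      rw [e₁, whisker_exchange_assoc, reassoc_of% e']; simp only [comp_whiskerRight]

/-- Write `m₀ ⊗ Π^L(m₁)` as `m₀ ⊗ m₁ λ(m₂)` and expand `m₀ ⊗ m₁` as the coaction of `q(m₀) h(m₁)`.
The antipode then cancels by `(x y₁) λ(y₂) = x Π^L(y)`. -/
theorem coact_piL :
    coact ≫ M ◁ piL H =
      coact ≫ (coinvEndo h act coact ≫ coact) ▷ H ≫ cross M H H ≫ hact h act ▷ H := by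
  have e : coact = coact ≫ coinvEndo h act coact ▷ H ≫ hact h act ≫ coact := by
    have := hM.coact_coinvEndo_hact hh =≫ coact
    simpa only [Category.assoc, Category.id_comp] using this.symm
  have es := hM.coact_split
  calc coact ≫ M ◁ piL H
      = coact ≫ coact ▷ H ≫ (M ⊗ H) ◁ antipode H ≫ join M uμ[H] := by
        rw [piL, conv_eq, whiskerLeft_id, id_whiskerRight, Category.id_comp, reassoc_of% es]
    _ = coact ≫ (coact ≫ coinvEndo h act coact ▷ H ≫ hact h act ≫ coact) ▷ H ≫
          (M ⊗ H) ◁ antipode H ≫ join M uμ[H] := by rw [← e]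
    _ = (coact ≫ coact ▷ H) ≫ (coinvEndo h act coact ▷ H ≫ coact ▷ H ≫ split (M ⊗ H) Δ[H] ≫
          cross M H H ▷ H ≫ hact h act ▷ H ▷ H ≫ join M uμ[H]) ▷ H ≫
          (M ⊗ H) ◁ antipode H ≫ join M uμ[H] := by
        rw [hM.hact_comp_coact hh]; simp only [comp_whiskerRight, Category.assoc]
    _ = coact ≫ (coinvEndo h act coact ≫ coact) ▷ H ≫ (split (M ⊗ H) Δ[H] ≫
          split (M ⊗ H) Δ[H] ▷ H) ≫ cross M H H ▷ H ▷ H ≫ hact h act ▷ H ▷ H ▷ H ≫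
          join M uμ[H] ▷ H ≫ (M ⊗ H) ◁ antipode H ≫ join M uμ[H] := by
        rw [← es]; simp only [join_nat, split_nat_assoc, ← whisker_exchange_assoc,
          comp_whiskerRight, Category.assoc, join_nat₁_assoc, split_nat₁_assoc]
    _ = coact ≫ (coinvEndo h act coact ≫ coact) ▷ H ≫ split (M ⊗ H) Δ[H] ≫
          cross M H H ▷ H ≫ hact h act ▷ H ▷ H ≫ (split (M ⊗ H) Δ[H] ≫
          join M uμ[H] ▷ H ≫ (M ⊗ H) ◁ antipode H ≫ join M uμ[H]) := by
        rw [← split_split]; simp only [join_nat, split_nat_assoc, ← whisker_exchange_assoc,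
          comp_whiskerRight, Category.assoc, join_nat₁_assoc]
    _ = coact ≫ coinvEndo h act coact ▷ H ≫ (coact ▷ H ≫ split (M ⊗ H) Δ[H] ≫
          cross M H H ▷ H ≫ hact h act ▷ H ▷ H ≫ (M ⊗ H) ◁ piL H ≫ join M uμ[H]) := by
        rw [join_split_antipode]; simp only [comp_whiskerRight, Category.assoc]
    _ = _ := by
        rw [hM.hact_comp_coact_piL hh]; simp only [comp_whiskerRight, Category.assoc]

/-- By `coact_piL` the right side is `(q(m₀)₀ h(m₁)) h(λ(m₂)) ⊗ q(m₀)₁`. The target axiom turns this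
into `q(m₀)₀ h(Π^L(m₁)) ⊗ q(m₀)₁`, the coaction of `q(m₀) h(Π^L(m₁)) = q(m)`. -/
theorem coinvEndo_coact :
    coinvEndo h act coact ≫ coact =
      coact ≫ split M Δ[H] ≫ cross M H H ≫ (M ◁ antipode H ≫ hact h act) ▷ H ≫ M ◁ piL H := by
  have es := hM.coact_split
  have e := cross_split_right M H Δ[H]
  symm
  calc _ = coact ≫ (coact ≫ M ◁ piL H) ▷ H ≫ cross M H H ≫
        (M ◁ antipode H ≫ hact h act) ▷ H := by
        rw [reassoc_of% es, ← whisker_exchange, ← reassoc_of% (cross_left M (piL H) H)]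
        simp only [comp_whiskerRight, Category.assoc]
    _ = (coact ≫ coact ▷ H) ≫ (coinvEndo h act coact ≫ coact) ▷ H ▷ H ≫ cross M H H ▷ H ≫
          hact h act ▷ H ▷ H ≫ cross M H H ≫ (M ◁ antipode H ≫ hact h act) ▷ H := by
        rw [hM.coact_piL hh]; simp only [comp_whiskerRight, Category.assoc]
    _ = coact ≫ (coinvEndo h act coact ≫ coact) ▷ H ≫ (split (M ⊗ H) Δ[H] ≫ cross M H H ▷ H ≫
          cross (M ⊗ H) H H) ≫ hact h act ▷ H ▷ H ≫ (M ◁ antipode H ≫ hact h act) ▷ H := by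
        rw [← es]; simp only [split_nat_assoc, cross_nat_assoc, comp_whiskerRight, Category.assoc]
    _ = coact ≫ coinvEndo h act coact ▷ H ≫ coact ▷ H ≫ cross M H H ≫ (split M Δ[H] ≫
          hact h act ▷ H ≫ M ◁ antipode H ≫ hact h act) ▷ H := by
        rw [e]; simp only [comp_whiskerRight, Category.assoc]
    _ = coact ≫ coinvEndo h act coact ▷ H ≫ M ◁ piL H ≫ hact h act ≫ coact := by
        rw [hM.hact_target, hM.piL_hact_coact hh]
    _ = (coact ≫ coinvEndo h act coact ▷ H ≫ M ◁ piL H ≫ hact h act) ≫ coact := by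
        simp only [Category.assoc]
    _ = _ := by rw [hM.coact_coinvEndo_target hh]

theorem coinvEndo_rbar :
    coinvEndo h act coact ≫ coact ≫ rbar H M = coinvEndo h act coact ≫ coact := by
  rw [reassoc_of% (hM.coinvEndo_coact hh), piL_rbar, hM.coinvEndo_coact hh]

-- Replacing `m₁` by `Π̄(m₁)` turns `m₁ b₁` into `ε(m₁ b₁) b₂` by `rbar_join`; `act_eq` absorbs the
-- scalar and leaves `m b₀ ⊗ b₁`.
omit hh in
theorem act_coact_of_rbar {Z : C} {f : Z ⟶ M} (hf : f ≫ coact ≫ rbar H M = f ≫ coact) :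
    f ▷ B ≫ act ≫ coact = f ▷ B ≫ split M (coactB H B) ≫ act ▷ H := by
  have e := cross_rbar (H := H) M B
  have ej := rbar_join (H := H) M
  calc f ▷ B ≫ act ≫ coact
      = (f ≫ coact ≫ rbar H M) ▷ B ≫ split (M ⊗ H) (coactB H B) ≫ cross M H B ▷ H ≫
          act ▷ H ▷ H ≫ join M uμ[H] := by
        rw [hf, hM.act_comp_coact]; simp only [comp_whiskerRight, Category.assoc]
    _ = (f ≫ coact) ▷ B ≫ split (M ⊗ H) (coactB H B) ≫ (rbar H M ▷ B ≫ cross M H B) ▷ H ≫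
          act ▷ H ▷ H ≫ join M uμ[H] := by
        simp only [join_nat, split_nat_assoc, comp_whiskerRight, Category.assoc]
    _ = (f ≫ coact) ▷ B ≫ split (M ⊗ H) (coactB H B) ≫ cross M H B ▷ H ≫
          (rbar H (M ⊗ B) ≫ act ▷ H) ▷ H ≫ join M uμ[H] := by
        rw [← e]; simp only [comp_whiskerRight, Category.assoc]
    _ = (f ≫ coact) ▷ B ≫ split (M ⊗ H) (coactB H B) ≫ cross M H B ▷ H ≫
          act ▷ H ▷ H ≫ split (M ⊗ H) Δ[H] ≫ pair H M ▷ H := by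
        rw [← rbar_nat]; simp only [comp_whiskerRight, Category.assoc, ej]
    _ = (f ≫ coact) ▷ B ≫ (split (M ⊗ H) (coactB H B) ≫ split ((M ⊗ H) ⊗ B) Δ[H]) ≫
          cross M H B ▷ H ▷ H ≫ act ▷ H ▷ H ▷ H ≫ pair H M ▷ H := by
        simp only [split_nat_assoc, comp_whiskerRight, Category.assoc, pair_nat₁]
    _ = f ▷ B ≫ split M (coactB H B) ≫ (coact ▷ B ≫ split (M ⊗ H) (coactB H B) ≫
          cross M H B ▷ H ≫ act ▷ H ▷ H ≫ pair H M) ▷ H := by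
        rw [coactB_split]; simp only [split_nat_assoc, pair_nat, comp_whiskerRight,
          Category.assoc, split_nat₁_assoc, pair_nat₁]
    _ = _ := by rw [← hM.act_eq]

/-- The case `b = 1` of `act_coact_of_rbar`, as the coaction of `1` is `h(1₁) ⊗ 1₂`. -/
theorem coact_of_rbar {Z : C} {f : Z ⟶ M} (hf : f ≫ coact ≫ rbar H M = f ≫ coact) :
    f ≫ coact = f ≫ cup H M ≫ hact h act ▷ H := by
  have e := create Z uη[B] ≫= hM.act_coact_of_rbar hf
  rw [← create_nat_assoc, reassoc_of% hM.create_act, ← create_nat_assoc,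
    reassoc_of% (hh.create_coactB M)] at e
  rw [e, hact, comp_whiskerRight]

theorem comp_coinvEndo_of_rbar {Z : C} {f : Z ⟶ M} (hf : f ≫ coact ≫ rbar H M = f ≫ coact) :
    f ≫ coinvEndo h act coact = f := by
  have e := hM.coact_of_rbar hh hf
  have es := hM.coact_split
  -- The coaction comes from `δ(1)`, whose last leg is fixed by `Π^L`. Hence `λ(m₁) Π^L(m₂)` may be
  -- replaced by `λ(m₁) m₂`, which is `Π^R(m₁)`.
  have e₁ : f ≫ coact ≫ split M Δ[H] ≫ (M ⊗ H) ◁ piL H = f ≫ coact ≫ split M Δ[H] := by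
    rw [reassoc_of% e, reassoc_of% e, split_nat, split_nat_assoc, reassoc_of% (cup_split (H := H) M),
      ← whisker_exchange, ← whisker_exchange_assoc, reassoc_of% (cup_piL (H := H) M),
      ← reassoc_of% (cup_split (H := H) M)]
  have el : M ◁ antipode H = M ◁ conv (antipode H) (piL H) := by
    rw [piL, antipode, WeakHopfQuasigroup.antipode_target]
  calc f ≫ coinvEndo h act coact
      = (f ≫ coact ≫ split M Δ[H] ≫ (M ⊗ H) ◁ piL H) ≫ (M ◁ antipode H) ▷ H ≫ join M uμ[H] ≫
          hact h act := by
        conv_lhs => rw [coinvEndo_eq, el, conv_eq]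
        simp only [Category.assoc, ← whisker_exchange_assoc]
    _ = f ≫ coact ≫ M ◁ piR H ≫ hact h act := by
        rw [e₁, piR, conv_eq, whiskerLeft_id, Category.id_comp]
        simp only [Category.assoc]
    _ = f := by rw [hM.coact_source hh, Category.comp_id]

theorem coinvEndo_idem : coinvEndo h act coact ≫ coinvEndo h act coact = coinvEndo h act coact :=
  hM.comp_coinvEndo_of_rbar hh (hM.coinvEndo_rbar hh)

theorem comp_coinvEndo_iff {Z : C} {f : Z ⟶ M} :
    f ≫ coinvEndo h act coact = f ↔ f ≫ coact ≫ rbar H M = f ≫ coact := by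
  refine ⟨fun hf => ?_, hM.comp_coinvEndo_of_rbar hh⟩
  rw [← hf, Category.assoc, Category.assoc, hM.coinvEndo_rbar hh]

theorem act_coact_of_coinv {Z : C} {f : Z ⟶ M} (hf : f ≫ coinvEndo h act coact = f) :
    f ▷ B ≫ act ≫ coact = f ▷ B ≫ split M (coactB H B) ≫ act ▷ H :=
  hM.act_coact_of_rbar ((hM.comp_coinvEndo_iff hh).1 hf)

/-- For coinvariant `m` the coaction of `m h(x)` is `m h(x₁) ⊗ x₂`, so `q(m h(x)) = (m h(x₁))
h(λ(x₂))` and the target axiom applies. -/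
theorem hact_coinvEndo_of_coinv {Z : C} {f : Z ⟶ M} (hf : f ≫ coinvEndo h act coact = f) :
    f ▷ H ≫ hact h act ≫ coinvEndo h act coact = f ▷ H ≫ M ◁ piL H ≫ hact h act := by
  have e := hM.act_coact_of_coinv hh hf
  rw [coinvEndo_eq, ← hM.hact_target, hact, Category.assoc, ← whisker_exchange_assoc,
    reassoc_of% e, whisker_exchange_assoc, reassoc_of% (hh.split_coactB M)]
  simp only [comp_whiskerRight, Category.assoc]

end IsPreHopfModule

theorem IsAnchor.nonempty_bCoinv [IsIdempotentComplete C] {h : H ⟶ B} (hh : IsAnchor h) :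
    Nonempty (BCoinv h) := by
  obtain ⟨Y, i, e, h₁, h₂⟩ := IsIdempotentComplete.idempotents_split B _
    (hh.isPreHopfModule.coinvEndo_idem hh)
  exact ⟨⟨Y, i, e, h₂, h₁⟩⟩

end PreHopfModule

/-! ### The monoid of coinvariants of `B` -/

section Coinvariants

variable {C : Type u} [Category.{v} C] [MonoidalCategory C] [BraidedCategory C]
variable {H B : C} [UnitalMagma H] [ComonObj H] [WeakHopfQuasigroup H] [UnitalMagma B]
  [ComoduleMagma H B]

theorem Splitting.i_comp {Y : C} {q : Y ⟶ Y} (s : Splitting q) : s.i ≫ q = s.i := by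
  have e := s.i ≫= s.p_i
  rwa [← Category.assoc, s.i_p, Category.id_comp, eq_comm] at e

theorem Splitting.comp_p {Y : C} {q : Y ⟶ Y} (s : Splitting q) : q ≫ s.p = s.p := by
  have e := s.p_i =≫ s.p
  rwa [Category.assoc, s.i_p, Category.comp_id, eq_comm] at e

theorem Splitting.mono_i {Y : C} {q : Y ⟶ Y} (s : Splitting q) : Mono s.i :=
  mono_of_mono_fac s.i_p

theorem rbar_tensor (X Y : C) :
    rbar H (X ⊗ Y) = (α_ X Y H).hom ≫ X ◁ rbar H Y ≫ (α_ X Y H).inv := by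
  simp only [rbar, cup, pair, create, split, join, erase]
  monoidal

theorem IsAnchor.unit_comp_coinvEndo {h : H ⟶ B} (hh : IsAnchor h) :
    uη[B] ≫ coinvEndo h uμ[B] (coactB H B) = uη[B] := by
  refine (hh.isPreHopfModule.comp_coinvEndo_iff hh).2 ?_
  have e : uη[H] ≫ Δ[H] = cup H (𝟙_ C) ≫ (λ_ H).hom ▷ H := by
    simp [cup, create, split, ← unitors_inv_equal]
  have e' := hh.colinear
  rw [← hh.magmaHom.unit, Category.assoc, Category.assoc, reassoc_of% e', e', rbar_nat,
    reassoc_of% e, rbar_nat_assoc, reassoc_of% (cup_rbar (H := H) (𝟙_ C)), reassoc_of% e]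

variable {h : H ⟶ B} {S : BCoinv h}

namespace IsPreHopfModule

variable {M : C} {act : M ⊗ B ⟶ M} {coact : M ⟶ M ⊗ H}

/-- For coinvariant `m` the coaction of `m b` is `m b₀ ⊗ b₁`, so the criterion for `m b` reduces to
the one for `b`. -/
theorem act_coinv_coinvEndo (hM : IsPreHopfModule h act coact) (hh : IsAnchor h) {Z : C}
    {f : Z ⟶ M} (hf : f ≫ coinvEndo h act coact = f) {Y : C} {g : Y ⟶ B}
    (hg : g ≫ coinvEndo h uμ[B] (coactB H B) = g) :
    (f ⊗ₘ g) ≫ act ≫ coinvEndo h act coact = (f ⊗ₘ g) ≫ act := by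
  have eg := (hh.isPreHopfModule.comp_coinvEndo_iff hh).1 hg
  have ef := hM.act_coact_of_coinv hh hf
  have e : (M ◁ g) ≫ split M (coactB H B) ≫ rbar H (M ⊗ B) = M ◁ g ≫ split M (coactB H B) := by
    simp only [split, rbar_tensor, Category.assoc, Iso.inv_hom_id_assoc]
    simp only [← whiskerLeft_comp_assoc, eg]
  have e' : (f ⊗ₘ g) ≫ act ≫ coact = f ▷ Y ≫ M ◁ g ≫ split M (coactB H B) ≫ act ▷ H := by
    rw [MonoidalCategory.tensorHom_def', Category.assoc, ef, whisker_exchange_assoc]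
  have := (hM.comp_coinvEndo_iff hh (f := (f ⊗ₘ g) ≫ act)).2 (by
    have e₂ := e' =≫ rbar H M
    simp only [Category.assoc] at e₂ ⊢
    rw [e₂, rbar_nat, reassoc_of% e, e'])
  simpa only [Category.assoc] using this

end IsPreHopfModule

/-- The monoid structure on the coinvariants of `B`. -/
@[reducible]
def coinvMonObj (hh : IsAnchor h) (S : BCoinv h)
    (a : (S.i ▷ B ≫ uμ[B]) ▷ B ≫ uμ[B] =
      (α_ S.obj B B).hom ≫ S.i ▷ (B ⊗ B) ≫ B ◁ uμ[B] ≫ uμ[B]) : MonObj S.obj :=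
  haveI := S.mono_i
  have e₁ : (uη[B] ≫ S.p) ≫ S.i = uη[B] := by
    rw [Category.assoc, S.p_i, hh.unit_comp_coinvEndo]
  have e₂ : ((S.i ⊗ₘ S.i) ≫ uμ[B] ≫ S.p) ≫ S.i = (S.i ⊗ₘ S.i) ≫ uμ[B] := by
    rw [Category.assoc, Category.assoc, S.p_i,
      hh.isPreHopfModule.act_coinv_coinvEndo hh S.i_comp S.i_comp]
  { one := uη[B] ≫ S.p
    mul := (S.i ⊗ₘ S.i) ≫ uμ[B] ≫ S.p
    one_mul := by
      rw [← cancel_mono S.i, Category.assoc, e₂, whiskerRight_comp_tensorHom_assoc, e₁,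
        tensorHom_def'_assoc, UnitalMagma.unit_mul, leftUnitor_naturality]
    mul_one := by
      rw [← cancel_mono S.i, Category.assoc, e₂, whiskerLeft_comp_tensorHom_assoc, e₁,
        MonoidalCategory.tensorHom_def_assoc, UnitalMagma.mul_unit, rightUnitor_naturality]
    mul_assoc := by
      rw [← cancel_mono S.i]
      rw [Category.assoc, e₂, Category.assoc, Category.assoc, e₂,
        whiskerRight_comp_tensorHom_assoc, whiskerLeft_comp_tensorHom_assoc, e₂]
      trans (S.obj ◁ S.i ⊗ₘ S.i) ≫ (S.i ▷ B ≫ uμ[B]) ▷ B ≫ uμ[B]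
      · rw [tensorHom_comp_whiskerRight_assoc]
        simp only [MonoidalCategory.tensorHom_def', Category.assoc]
      · rw [a, ← id_tensorHom, associator_naturality_assoc,
          tensorHom_comp_whiskerRight_assoc, tensorHom_comp_whiskerLeft_assoc, Category.id_comp] }

end Coinvariants

/-! ### Balanced tensor products, and linearity of `q` over coinvariants -/

section Comparison

variable {C : Type u} [Category.{v} C] [MonoidalCategory C]

theorem nonempty_isColimit_cofork_whiskerRight {P Q R : C} {f g : P ⟶ Q} {π : Q ⟶ R}
    (w : f ≫ π = g ≫ π) (hπ : Nonempty (IsColimit (Cofork.ofπ π w))) (Y : C)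
    [PreservesColimitsOfShape WalkingParallelPair (tensorRight Y)] :
    ∃ w' : f ▷ Y ≫ π ▷ Y = g ▷ Y ≫ π ▷ Y, Nonempty (IsColimit (Cofork.ofπ (π ▷ Y) w')) :=
  ⟨by simp only [← comp_whiskerRight, w],
    ⟨isColimitCoforkMapOfIsColimit (tensorRight Y) w hπ.some⟩⟩

variable [BraidedCategory C]
variable {H B : C} [UnitalMagma H] [ComonObj H] [WeakHopfQuasigroup H] [UnitalMagma B]
  [ComoduleMagma H B] {h : H ⟶ B} {S : BCoinv h}

namespace IsBalancedTensor

variable {N T : C} {ψ : N ⊗ S.obj ⟶ N} {n : N ⊗ B ⟶ T} (hn : IsBalancedTensor S ψ n)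
include hn

theorem eq : ψ ▷ B ≫ n = (N ◁ S.i) ▷ B ≫ join N uμ[B] ≫ n := by
  obtain ⟨w, -⟩ := hn
  rw [w]
  simp [join]

theorem epi : Epi n := by
  obtain ⟨w, ⟨l⟩⟩ := hn
  exact epi_of_isColimit_cofork l

theorem exists_desc {Z : C} (g : N ⊗ B ⟶ Z)
    (hg : ψ ▷ B ≫ g = (N ◁ S.i) ▷ B ≫ join N uμ[B] ≫ g) : ∃ g' : T ⟶ Z, n ≫ g' = g := by
  obtain ⟨w, ⟨l⟩⟩ := hn
  exact ⟨Cofork.IsColimit.desc l g (by rw [hg]; simp [join]), Cofork.IsColimit.π_desc' l g _⟩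

variable [PreservesColimitsOfShape WalkingParallelPair (tensorRight B)]

theorem exists_desc_whiskerRight {Z : C} (g : (N ⊗ B) ⊗ B ⟶ Z)
    (hg : ψ ▷ B ▷ B ≫ g = (N ◁ S.i) ▷ B ▷ B ≫ join N uμ[B] ▷ B ≫ g) :
    ∃ g' : T ⊗ B ⟶ Z, n ▷ B ≫ g' = g := by
  obtain ⟨w, l⟩ := hn
  obtain ⟨w', ⟨l'⟩⟩ := nonempty_isColimit_cofork_whiskerRight w l B
  exact ⟨Cofork.IsColimit.desc l' g (by rw [hg]; simp [join]), Cofork.IsColimit.π_desc' l' g _⟩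

theorem epi_whiskerRight (Y : C)
    [PreservesColimitsOfShape WalkingParallelPair (tensorRight Y)] : Epi (n ▷ Y) := by
  obtain ⟨w, l⟩ := hn
  obtain ⟨w', ⟨l'⟩⟩ := nonempty_isColimit_cofork_whiskerRight w l Y
  exact epi_of_isColimit_cofork l'

/-- Tensoring with `B^{co H}` is not assumed to preserve coequalizers, but `B^{co H}` is a retract
of `B`, for which this holds. -/
theorem epi_coinv_whiskerRight : Epi (n ▷ S.obj ▷ B) := by
  obtain ⟨w, l⟩ := hn
  obtain ⟨w', l'⟩ := nonempty_isColimit_cofork_whiskerRight w l B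
  obtain ⟨w'', ⟨l''⟩⟩ := nonempty_isColimit_cofork_whiskerRight w' l' B
  have : Epi (n ▷ B ▷ B) := epi_of_isColimit_cofork l''
  have : IsSplitEpi ((T ◁ S.p) ▷ B) :=
    ⟨⟨(T ◁ S.i) ▷ B, by rw [← comp_whiskerRight, ← whiskerLeft_comp, S.i_p]; simp⟩⟩
  have : Epi (((N ⊗ B) ◁ S.p) ▷ B ≫ n ▷ S.obj ▷ B) := by
    rw [← comp_whiskerRight, whisker_exchange, comp_whiskerRight]
    exact epi_comp _ _
  exact epi_of_epi (((N ⊗ B) ◁ S.p) ▷ B) _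

end IsBalancedTensor

theorem coact_coinvEndo_hact_strand (hh : IsAnchor h) (S : BCoinv h) (X : C) :
    split X (coactB H B) ≫ (X ◁ S.p) ▷ H ≫ (X ◁ S.i) ▷ H ≫ join X (hact h uμ[B]) = 𝟙 _ := by
  have e := congrArg (fun f => X ◁ f) (hh.isPreHopfModule.coact_coinvEndo_hact hh)
  rw [← S.p_i] at e
  simp only [whiskerLeft_comp, comp_whiskerRight, whiskerLeft_id, Category.assoc] at e
  rw [← e]
  simp [split, join]

theorem coact_coinvEndo_target_strand (hh : IsAnchor h) (S : BCoinv h) (X : C) :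
    split X (coactB H B) ≫ (X ◁ S.p) ▷ H ≫ (X ◁ S.i) ▷ H ≫ (X ⊗ B) ◁ piL H ≫
      join X (hact h uμ[B]) = X ◁ S.p ≫ X ◁ S.i := by
  have e := congrArg (fun f => X ◁ f) (hh.isPreHopfModule.coact_coinvEndo_target hh)
  rw [← S.p_i] at e
  simp only [whiskerLeft_comp, comp_whiskerRight, Category.assoc] at e
  rw [← e]
  simp [split, join]

theorem whiskerLeft_join (X : C) :
    (X ⊗ B) ◁ h ≫ join X uμ[B] = join X (hact h uμ[B]) := by
  simp [join, hact]

namespace StrongHopfModule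

variable (M : StrongHopfModule h S)

theorem coinv_join_act :
    (M.X ◁ S.i) ▷ B ≫ join M.X uμ[B] ≫ M.act = (M.X ◁ S.i) ▷ B ≫ M.act ▷ B ≫ M.act := by
  have e := M.act_coinv
  rw [comp_whiskerRight, Category.assoc] at e
  rw [e]
  simp [join]

theorem coinv_join_hact :
    (M.X ◁ S.i) ▷ H ≫ join M.X (hact h uμ[B]) ≫ M.act =
      (M.X ◁ S.i ≫ M.act) ▷ H ≫ hact h M.act := by
  rw [← whiskerLeft_join, Category.assoc, ← whisker_exchange_assoc, M.coinv_join_act, hact,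
    ← whisker_exchange_assoc]
  simp only [comp_whiskerRight, Category.assoc]

variable (hh : IsAnchor h)
include hh

theorem act_coinv_q {Z : C} {f : Z ⟶ M.X} (hf : f ≫ M.q = f) :
    (f ⊗ₘ S.i) ≫ M.act ≫ M.q = (f ⊗ₘ S.i) ≫ M.act :=
  M.isPreHopfModule.act_coinv_coinvEndo hh hf S.i_comp

/-- With `b = q(b₀) h(b₁)`, `m b = (m q(b₀)) h(b₁)` where `m q(b₀)` is again coinvariant. Applying
`q` replaces `h(b₁)` by `h(Π^L(b₁))`, and rebracketing gives `m (q(b₀) h(Π^L(b₁))) = m q(b)`. -/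
theorem act_q {Z : C} {f : Z ⟶ M.X} (hf : f ≫ M.q = f) :
    f ▷ B ≫ M.act ≫ M.q = f ▷ B ≫ M.X ◁ S.p ≫ M.X ◁ S.i ≫ M.act := by
  have e := M.act_coinv_q hh hf
  have hg := M.isPreHopfModule.hact_coinvEndo_of_coinv hh
    (f := (f ⊗ₘ S.i) ≫ M.act) (by rw [Category.assoc]; exact e)
  rw [MonoidalCategory.tensorHom_def] at hg
  have ej := M.coinv_join_hact
  calc f ▷ B ≫ M.act ≫ M.q
      = f ▷ B ≫ split M.X (coactB H B) ≫ (M.X ◁ S.p) ▷ H ≫ ((M.X ◁ S.i) ▷ H ≫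
          join M.X (hact h uμ[B]) ≫ M.act) ≫ M.q := by
        have := coact_coinvEndo_hact_strand hh S M.X =≫ M.act ≫ M.q
        simp only [Category.assoc, Category.id_comp] at this ⊢
        rw [this]
    _ = split Z (coactB H B) ≫ (Z ◁ S.p) ▷ H ≫ ((f ▷ S.obj ≫ M.X ◁ S.i) ≫ M.act) ▷ H ≫
          hact h M.act ≫ coinvEndo h M.act M.coact := by
        rw [ej, split_nat_assoc, ← comp_whiskerRight_assoc, ← whisker_exchange]
        simp only [comp_whiskerRight, Category.assoc]
        rfl
    _ = f ▷ B ≫ split M.X (coactB H B) ≫ (M.X ◁ S.p) ▷ H ≫ ((M.X ◁ S.i) ≫ M.act) ▷ H ≫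
          M.X ◁ piL H ≫ hact h M.act := by
        rw [hg, split_nat_assoc, ← comp_whiskerRight_assoc (f ▷ B), ← whisker_exchange f S.p]
        simp only [comp_whiskerRight, Category.assoc]
    _ = f ▷ B ≫ (split M.X (coactB H B) ≫ (M.X ◁ S.p) ▷ H ≫ (M.X ◁ S.i) ▷ H ≫
          (M.X ⊗ B) ◁ piL H ≫ join M.X (hact h uμ[B])) ≫ M.act := by
        simp only [Category.assoc]
        rw [← whisker_exchange_assoc, ← ej, whisker_exchange_assoc]
    _ = _ := by rw [coact_coinvEndo_target_strand hh]; simp only [Category.assoc]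

theorem coinvAct_i (s : Splitting M.q) :
    M.coinvAct s ≫ s.i = (s.i ⊗ₘ S.i) ≫ M.act := by
  rw [coinvAct, Category.assoc, Category.assoc, s.p_i, M.act_coinv_q hh s.i_comp]

theorem act_p (s : Splitting M.q) :
    s.i ▷ B ≫ M.act ≫ s.p = s.obj ◁ S.p ≫ M.coinvAct s := by
  have e := M.act_q hh s.i_comp =≫ s.p
  simp only [Category.assoc, s.comp_p] at e
  rw [e, coinvAct, MonoidalCategory.tensorHom_def, Category.assoc, ← whisker_exchange_assoc,
    whisker_exchange_assoc]

end StrongHopfModule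

end Comparison

/-! ### Induced strong Hopf modules -/

section Induced

variable {C : Type u} [Category.{v} C] [MonoidalCategory C] [BraidedCategory C]
variable {H B : C} [UnitalMagma H] [ComonObj H] [WeakHopfQuasigroup H] [UnitalMagma B]
  [ComoduleMagma H B] {h : H ⟶ B}

theorem act_target_strand {M : C} (act : M ⊗ B ⟶ M) :
    M ◁ Δ[H] ⊗≫ ((M ◁ h ≫ act) ⊗ₘ (antipode H ≫ h)) ≫ act =
      split M Δ[H] ≫ hact h act ▷ H ≫ M ◁ antipode H ≫ hact h act := by
  simp only [hact, split, MonoidalCategory.tensorHom_def]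
  monoidal

theorem act_source_strand {M : C} (act : M ⊗ B ⟶ M) :
    M ◁ Δ[H] ⊗≫ ((M ◁ (antipode H ≫ h) ≫ act) ⊗ₘ h) ≫ act =
      split M Δ[H] ≫ (M ◁ antipode H ≫ hact h act) ▷ H ≫ hact h act := by
  simp only [hact, split, MonoidalCategory.tensorHom_def]
  monoidal

theorem whiskerLeft_comp_act {M : C} (act : M ⊗ B ⟶ M) (f : H ⟶ H) :
    M ◁ (f ≫ h) ≫ act = M ◁ f ≫ hact h act := by
  simp [hact]

theorem act_coact_strand {M : C} (act : M ⊗ B ⟶ M) (coact : M ⟶ M ⊗ H) :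
    (coact ⊗ₘ coactB H B) ≫ tensorμ M H B H ≫ (act ⊗ₘ uμ[H]) =
      coact ▷ B ≫ split (M ⊗ H) (coactB H B) ≫ cross M H B ▷ H ≫ act ▷ H ▷ H ≫
        join M uμ[H] := by
  simp only [tensorμ, cross, join, split, MonoidalCategory.tensorHom_def]
  monoidal

namespace IsPreHopfModule

variable {M : C} {act : M ⊗ B ⟶ M} {coact : M ⟶ M ⊗ H}
  (hM : IsPreHopfModule h act coact)
include hM

theorem tensor (N : C) : IsPreHopfModule h (join N act) (split N coact) where
  comodule :=
    { counit := by
        have e := congrArg (fun f => N ◁ f) hM.comodule.counit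
        simp only [whiskerLeft_comp] at e
        simp [split, reassoc_of% e]
      coassoc := by
        have e := congrArg (fun f => N ◁ f) hM.comodule.coassoc
        simp only [whiskerLeft_comp] at e
        simp [split, reassoc_of% e] }
  act_unit := by
    have e := congrArg (fun f => N ◁ f) hM.act_unit
    simp only [whiskerLeft_comp] at e
    simp [join, e]
  act_coact := by
    have e := congrArg (fun f => (α_ N M B).hom ≫ N ◁ f ≫ (α_ N M H).inv) hM.act_coact
    trans (α_ N M B).hom ≫ N ◁ (act ≫ coact) ≫ (α_ N M H).inv
    · simp [join, split]
    · refine e.trans ?_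
      simp only [tensorμ, join, split, MonoidalCategory.tensorHom_def]
      monoidal
  act_target := by
    have e := hM.act_target
    rw [act_target_strand, whiskerLeft_comp_act] at e ⊢
    replace e := congrArg (fun f => (α_ N M H).hom ≫ N ◁ f) e
    simp only [split, hact, join] at e ⊢
    simp only [comp_whiskerRight, whiskerLeft_comp, Category.assoc] at e ⊢
    simp at e ⊢
    exact e
  act_source := by
    have e := hM.act_source
    rw [act_source_strand, whiskerLeft_comp_act] at e ⊢
    replace e := congrArg (fun f => (α_ N M H).hom ≫ N ◁ f) e
    simp only [split, hact, join] at e ⊢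
    simp only [comp_whiskerRight, whiskerLeft_comp, Category.assoc] at e ⊢
    simp at e ⊢
    exact e

/-- Used to descend the axioms from `N ⊗ B`, where they come from `B`, to the balanced tensor
product. -/
theorem quotient {T : C} {n : M ⟶ T} [Epi n] [Epi (n ▷ B)] [Epi (n ▷ H)] {tact : T ⊗ B ⟶ T}
    {tcoact : T ⟶ T ⊗ H} (ha : n ▷ B ≫ tact = act ≫ n) (hc : n ≫ tcoact = coact ≫ n ▷ H) :
    IsPreHopfModule h tact tcoact where
  comodule :=
    { counit := by
        rw [← cancel_epi n, reassoc_of% hc, ← whisker_exchange, reassoc_of% hM.comodule.counit]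
        simp
      coassoc := by
        rw [← cancel_epi n, reassoc_of% hc, ← whisker_exchange, reassoc_of% hM.comodule.coassoc,
          reassoc_of% hc, ← comp_whiskerRight_assoc, hc]
        simp }
  act_unit := by
    have e : create T uη[B] ≫ tact = 𝟙 T := by
      rw [← cancel_epi n, create_nat_assoc, ha, reassoc_of% hM.create_act, Category.comp_id]
    rw [create, Category.assoc, Iso.inv_comp_eq, Category.comp_id] at e
    exact e
  act_coact := by
    have e := hM.act_coact
    rw [act_coact_strand] at e ⊢
    have hc' : n ▷ B ≫ tcoact ▷ B = coact ▷ B ≫ n ▷ H ▷ B := by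
      rw [← comp_whiskerRight, hc, comp_whiskerRight]
    have ha' : n ▷ B ▷ H ▷ H ≫ tact ▷ H ▷ H = act ▷ H ▷ H ≫ n ▷ H ▷ H := by
      simp only [← comp_whiskerRight, ha]
    have hx : n ▷ H ▷ B ▷ H ≫ cross T H B ▷ H = cross M H B ▷ H ≫ n ▷ B ▷ H ▷ H := by
      simp only [← comp_whiskerRight, cross_nat]
    rw [← cancel_epi (n ▷ B), reassoc_of% ha, hc, reassoc_of% e, reassoc_of% hc', split_nat_assoc (n ▷ H),
      reassoc_of% hx, reassoc_of% ha', join_nat]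
  act_target := by
    have e := hM.act_target
    have hh : n ▷ H ≫ hact h tact = hact h act ≫ n := by
      rw [hact, ← whisker_exchange_assoc, ha, hact, Category.assoc]
    rw [act_target_strand, whiskerLeft_comp_act] at e ⊢
    rw [← cancel_epi (n ▷ H), split_nat_assoc, ← comp_whiskerRight_assoc, hh,
      comp_whiskerRight_assoc, ← whisker_exchange_assoc, hh, reassoc_of% e,
      ← whisker_exchange_assoc, hh]
  act_source := by
    have e := hM.act_source
    have hh : n ▷ H ≫ hact h tact = hact h act ≫ n := by
      rw [hact, ← whisker_exchange_assoc, ha, hact, Category.assoc]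
    rw [act_source_strand, whiskerLeft_comp_act] at e ⊢
    rw [← cancel_epi (n ▷ H), split_nat_assoc, ← comp_whiskerRight_assoc,
      ← whisker_exchange_assoc, hh, ← Category.assoc (M ◁ _), comp_whiskerRight_assoc, hh,
      reassoc_of% e, ← whisker_exchange_assoc, hh]

end IsPreHopfModule

variable {S : BCoinv h}

theorem mul_coact_strand (hh : IsAnchor h) (X : C) :
    (X ◁ S.i) ▷ B ≫ join X uμ[B] ≫ split X (coactB H B) =
      (X ◁ S.i) ▷ B ≫ split (X ⊗ B) (coactB H B) ≫ join X uμ[B] ▷ H := by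
  have e := congrArg (fun f => (α_ X _ _).hom ≫ X ◁ f)
    (hh.isPreHopfModule.act_coact_of_coinv hh S.i_comp)
  simp [split] at e
  simp [join, split, reassoc_of% e]

theorem coinv_mul_assoc_strand
    (a : (S.i ▷ B ≫ uμ[B]) ▷ B ≫ uμ[B] =
      (α_ S.obj B B).hom ≫ S.i ▷ (B ⊗ B) ≫ B ◁ uμ[B] ≫ uμ[B]) (X : C) :
    (X ◁ S.i) ▷ B ▷ B ≫ join X uμ[B] ▷ B ≫ join X uμ[B] =
      (X ◁ S.i) ▷ B ▷ B ≫ join (X ⊗ B) uμ[B] ≫ join X uμ[B] := by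
  have e := congrArg (fun f => (α_ X _ _).hom ▷ B ≫ (α_ X _ _).hom ≫ X ◁ f) a
  simp at e
  simp [join, e]

theorem mul_coinv_assoc_strand
    (a : (B ◁ S.i ≫ uμ[B]) ▷ B ≫ uμ[B] =
      (α_ B S.obj B).hom ≫ B ◁ (S.i ▷ B ≫ uμ[B]) ≫ uμ[B]) (X : C) :
    ((X ⊗ B) ◁ S.i) ▷ B ≫ join X uμ[B] ▷ B ≫ join X uμ[B] =
      ((X ⊗ B) ◁ S.i) ▷ B ≫ join (X ⊗ B) uμ[B] ≫ join X uμ[B] := by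
  have e := congrArg (fun f => (α_ X _ _).hom ▷ B ≫ (α_ X _ _).hom ≫ X ◁ f) a
  simp at e
  simp [join, e]

section Existence

variable {N T : C} {ψ : N ⊗ S.obj ⟶ N} {n : N ⊗ B ⟶ T}

theorem isInducedStructure_iff {tact : T ⊗ B ⟶ T} {tcoact : T ⟶ T ⊗ H} :
    IsInducedStructure n tact tcoact ↔
      n ▷ B ≫ tact = join N uμ[B] ≫ n ∧ n ≫ tcoact = split N (coactB H B) ≫ n ▷ H := by
  simp only [join, split, Category.assoc]
  exact ⟨fun e => ⟨e.act, e.coact⟩, fun e => ⟨e.1, e.2⟩⟩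

variable [PreservesColimitsOfShape WalkingParallelPair (tensorRight B)]

/-- The product descends by associativity with a coinvariant left factor; the coaction descends
because `ρ(a b) = a b₀ ⊗ b₁` for coinvariant `a`. -/
theorem IsBalancedTensor.exists_isInducedStructure (hn : IsBalancedTensor S ψ n)
    (hh : IsAnchor h) (a : (S.i ▷ B ≫ uμ[B]) ▷ B ≫ uμ[B] =
      (α_ S.obj B B).hom ≫ S.i ▷ (B ⊗ B) ≫ B ◁ uμ[B] ≫ uμ[B]) :
    ∃ (tact : T ⊗ B ⟶ T) (tcoact : T ⟶ T ⊗ H), IsInducedStructure n tact tcoact := by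
  have ea := coinv_mul_assoc_strand a N
  have ec := mul_coact_strand (S := S) hh N
  obtain ⟨tact, h₁⟩ := hn.exists_desc_whiskerRight (join N uμ[B] ≫ n) (by
    rw [join_nat_assoc, hn.eq, reassoc_of% ea, join_nat_assoc])
  obtain ⟨tcoact, h₂⟩ := hn.exists_desc (split N (coactB H B) ≫ n ▷ H) (by
    rw [split_nat_assoc, ← comp_whiskerRight, hn.eq, reassoc_of% ec, split_nat_assoc]
    simp only [comp_whiskerRight])
  exact ⟨tact, tcoact, isInducedStructure_iff.2 ⟨h₁, h₂⟩⟩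

variable [PreservesColimitsOfShape WalkingParallelPair (tensorRight H)]

theorem IsBalancedTensor.isPreHopfModule (hn : IsBalancedTensor S ψ n) (hh : IsAnchor h)
    {tact : T ⊗ B ⟶ T} {tcoact : T ⟶ T ⊗ H} (ht : IsInducedStructure n tact tcoact) :
    IsPreHopfModule h tact tcoact := by
  have := hn.epi
  have := hn.epi_whiskerRight B
  have := hn.epi_whiskerRight H
  obtain ⟨h₁, h₂⟩ := isInducedStructure_iff.1 ht
  exact (hh.isPreHopfModule.tensor N).quotient h₁ h₂

/-- The strong Hopf module `N ⊗_{B^{co H}} B`. -/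
def IsBalancedTensor.strongHopfModule (hn : IsBalancedTensor S ψ n) (hh : IsAnchor h)
    (a : (B ◁ S.i ≫ uμ[B]) ▷ B ≫ uμ[B] =
      (α_ B S.obj B).hom ≫ B ◁ (S.i ▷ B ≫ uμ[B]) ≫ uμ[B])
    {tact : T ⊗ B ⟶ T} {tcoact : T ⟶ T ⊗ H} (ht : IsInducedStructure n tact tcoact) :
    StrongHopfModule h S :=
  have hT := hn.isPreHopfModule hh ht
  { X := T
    act := tact
    coact := tcoact
    comodule := hT.comodule
    act_unit := hT.act_unit
    -- Here associativity with the coinvariant in the middle enters. It is checked on `N ⊗ B ⊗ B^{co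
    -- H} ⊗ B`.
    act_coinv := by
      have := hn.epi_coinv_whiskerRight
      have e := mul_coinv_assoc_strand a N
      have h₁ := (isInducedStructure_iff.1 ht).1
      have h₂ : n ▷ S.obj ▷ B ≫ (T ◁ S.i) ▷ B = ((N ⊗ B) ◁ S.i) ▷ B ≫ n ▷ B ▷ B := by
        simp only [← comp_whiskerRight, whisker_exchange]
      have h₃ : n ▷ B ▷ B ≫ tact ▷ B = join N uμ[B] ▷ B ≫ n ▷ B := by
        simp only [← comp_whiskerRight, h₁]
      have h₄ : (α_ T S.obj B).hom ≫ T ◁ (S.i ▷ B ≫ uμ[B]) = (T ◁ S.i) ▷ B ≫ join T uμ[B] := by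
        simp [join]
      rw [← cancel_epi (n ▷ S.obj ▷ B), reassoc_of% h₄, comp_whiskerRight_assoc,
        reassoc_of% h₂, reassoc_of% h₃, h₁, reassoc_of% e, reassoc_of% h₂, join_nat_assoc, h₁]
    act_coact := hT.act_coact
    act_target := hT.act_target
    act_source := hT.act_source }

end Existence

end Induced

/-! ### The comparison isomorphism and the deformed action -/

section Comparison

variable {C : Type u} [Category.{v} C] [MonoidalCategory C] [BraidedCategory C]
variable {H B : C} [UnitalMagma H] [ComonObj H] [WeakHopfQuasigroup H] [UnitalMagma B]
  [ComoduleMagma H B] {h : H ⟶ B} {S : BCoinv h}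

theorem IsBalancedTensor.exists_of_hasCoequalizers [HasCoequalizers C] (S : BCoinv h) {N : C}
    (ψ : N ⊗ S.obj ⟶ N) : ∃ (T : C) (n : N ⊗ B ⟶ T), IsBalancedTensor S ψ n :=
  ⟨_, coequalizer.π (ψ ▷ B) ((α_ N S.obj B).hom ≫ N ◁ (S.i ▷ B ≫ uμ[B])),
    coequalizer.condition _ _, ⟨coequalizerIsCoequalizer _ _⟩⟩

namespace StrongHopfModule

variable (M : StrongHopfModule h S)

/-- The explicit form `m ⊗ b ↦ q(m₀) (h(m₁) b)` of the deformed action. -/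
def twistedAct : M.X ⊗ B ⟶ M.X :=
  (M.coact ≫ M.q ▷ H ≫ M.X ◁ h) ▷ B ≫ join M.X uμ[B] ≫ M.act

theorem coinvAct_act (hh : IsAnchor h) (s : Splitting M.q) :
    M.coinvAct s ▷ B ≫ s.i ▷ B ≫ M.act =
      (s.obj ◁ S.i) ▷ B ≫ join s.obj uμ[B] ≫ s.i ▷ B ≫ M.act := by
  rw [← join_nat_assoc, ← comp_whiskerRight_assoc, M.coinvAct_i hh]
  have e := M.coinv_join_act
  have e' : (s.obj ◁ S.i) ▷ B ≫ s.i ▷ B ▷ B = s.i ▷ S.obj ▷ B ≫ (M.X ◁ S.i) ▷ B := by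
    simp only [← comp_whiskerRight, whisker_exchange]
  rw [reassoc_of% e', e, MonoidalCategory.tensorHom_def]
  simp only [comp_whiskerRight, Category.assoc]

theorem coact_coinv_act (hh : IsAnchor h) (s : Splitting M.q) :
    (M.coact ≫ s.p ▷ H ≫ s.obj ◁ h) ≫ s.i ▷ B ≫ M.act = 𝟙 M.X := by
  have e := M.isPreHopfModule.coact_coinvEndo_hact hh
  have e' : s.p ▷ H ≫ s.i ▷ H = coinvEndo h M.act M.coact ▷ H := by
    rw [← comp_whiskerRight, s.p_i, q]
  simp only [Category.assoc]
  rw [whisker_exchange_assoc, reassoc_of% e']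
  exact e

/-- For coinvariant `m`, the element `p(m b₀) ⊗ h(b₁)` is `m p(b₀) ⊗ h(b₁)`; balancing makes it `m ⊗
q(b₀) h(b₁) = m ⊗ b`. -/
theorem inv_comp_hom (hh : IsAnchor h) (s : Splitting M.q) {T : C} {n : s.obj ⊗ B ⟶ T}
    (hn : IsBalancedTensor S (M.coinvAct s) n) :
    s.i ▷ B ≫ M.act ≫ (M.coact ≫ s.p ▷ H ≫ s.obj ◁ h) ≫ n = n := by
  have e := M.isPreHopfModule.act_coact_of_coinv hh s.i_comp
  have ep := M.act_p hh s
  have ec := coact_coinvEndo_hact_strand hh S s.obj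
  have en := hn.eq
  calc _ = split s.obj (coactB H B) ≫ (s.i ▷ B ≫ M.act ≫ s.p) ▷ H ≫ s.obj ◁ h ≫ n := by
        simp only [Category.assoc, comp_whiskerRight]
        rw [reassoc_of% e, split_nat_assoc]
    _ = split s.obj (coactB H B) ≫ (s.obj ◁ S.p) ▷ H ≫ (s.obj ⊗ S.obj) ◁ h ≫
          M.coinvAct s ▷ B ≫ n := by
        rw [ep, comp_whiskerRight_assoc, whisker_exchange_assoc]
    _ = (split s.obj (coactB H B) ≫ (s.obj ◁ S.p) ▷ H ≫ (s.obj ◁ S.i) ▷ H ≫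
          join s.obj (hact h uμ[B])) ≫ n := by
        rw [en, whisker_exchange_assoc, ← whiskerLeft_join]
        simp only [Category.assoc]
    _ = n := by rw [ec, Category.id_comp]

theorem exists_comparisonIso (hh : IsAnchor h) (s : Splitting M.q) {T : C}
    {n : s.obj ⊗ B ⟶ T} (hn : IsBalancedTensor S (M.coinvAct s) n) {tact : T ⊗ B ⟶ T}
    {tcoact : T ⟶ T ⊗ H} (ht : IsInducedStructure n tact tcoact) :
    ∃ ω : T ≅ M.X, n ≫ ω.hom = s.i ▷ B ≫ M.act ∧ ω.hom ≫ M.coact = tcoact ≫ ω.hom ▷ H := by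
  have := hn.epi
  obtain ⟨ω, hω⟩ := hn.exists_desc (s.i ▷ B ≫ M.act) (M.coinvAct_act hh s)
  have hc := (isInducedStructure_iff.1 ht).2
  have hi := M.inv_comp_hom hh s hn
  have hi' := M.coact_coinv_act hh s
  refine ⟨⟨ω, (M.coact ≫ s.p ▷ H ≫ s.obj ◁ h) ≫ n, ?_, ?_⟩, hω, ?_⟩
  · rw [← cancel_epi n, reassoc_of% hω, hi, Category.comp_id]
  · rw [Category.assoc, hω, hi']
  · have e := M.isPreHopfModule.act_coact_of_coinv hh s.i_comp
    rw [← cancel_epi n, reassoc_of% hω, reassoc_of% hc, ← comp_whiskerRight, hω, e,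
      split_nat_assoc, comp_whiskerRight]

theorem nonempty_comparison [IsIdempotentComplete C] [HasCoequalizers C]
    [PreservesColimitsOfShape WalkingParallelPair (tensorRight B)] (hh : IsAnchor h)
    (a : (S.i ▷ B ≫ uμ[B]) ▷ B ≫ uμ[B] =
      (α_ S.obj B B).hom ≫ S.i ▷ (B ⊗ B) ≫ B ◁ uμ[B] ≫ uμ[B]) : Nonempty M.Comparison := by
  obtain ⟨Y, i, p, h₁, h₂⟩ := IsIdempotentComplete.idempotents_split M.X M.q
    (M.isPreHopfModule.coinvEndo_idem hh)
  let s : Splitting M.q := ⟨Y, i, p, h₂, h₁⟩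
  obtain ⟨T, n, hn⟩ := IsBalancedTensor.exists_of_hasCoequalizers S (M.coinvAct s)
  obtain ⟨tact, tcoact, ht⟩ := hn.exists_isInducedStructure hh a
  obtain ⟨ω, hω, hc⟩ := M.exists_comparisonIso hh s hn ht
  exact ⟨⟨s, T, n, hn, tact, tcoact, ht, ω, hω, hc⟩⟩

variable {M} in
theorem Comparison.ω_inv (D : M.Comparison) (hh : IsAnchor h) :
    D.ω.inv = (M.coact ≫ D.coinv.p ▷ H ≫ D.coinv.obj ◁ h) ≫ D.n := by
  refine ((Iso.comp_hom_eq_id D.ω).1 ?_).symm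
  rw [Category.assoc, D.n_ω, M.coact_coinv_act hh]

-- In the explicit inverse of the comparison isomorphism the image enters only through `i ∘ p = q`,
-- and the coequalizer disappears on composing with `ω`.
variable {M} in
theorem Comparison.deformed_eq (D : M.Comparison) (hh : IsAnchor h) :
    D.deformed = M.twistedAct := by
  have ea := (isInducedStructure_iff.1 D.induced).1
  have e := D.n_ω
  rw [Comparison.deformed, D.ω_inv hh, twistedAct, comp_whiskerRight_assoc, reassoc_of% ea, e,
    ← join_nat_assoc, ← comp_whiskerRight_assoc]
  simp only [Category.assoc]
  rw [whisker_exchange, ← comp_whiskerRight_assoc, D.coinv.p_i]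

theorem deformedAct_eq [IsIdempotentComplete C] [HasCoequalizers C]
    [PreservesColimitsOfShape WalkingParallelPair (tensorRight B)] (hh : IsAnchor h)
    (a : (S.i ▷ B ≫ uμ[B]) ▷ B ≫ uμ[B] =
      (α_ S.obj B B).hom ≫ S.i ▷ (B ⊗ B) ≫ B ◁ uμ[B] ≫ uμ[B]) :
    M.deformedAct = M.twistedAct := by
  rw [deformedAct, dif_pos (M.nonempty_comparison hh a), Comparison.deformed_eq _ hh]

/-- For coinvariant `m` the inverse comparison is `m ⊗ 1`, so the deformed action is `m (1 b)`. -/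
theorem i_deformedAct [IsIdempotentComplete C] [HasCoequalizers C]
    [PreservesColimitsOfShape WalkingParallelPair (tensorRight B)] (hh : IsAnchor h)
    (a : (S.i ▷ B ≫ uμ[B]) ▷ B ≫ uμ[B] =
      (α_ S.obj B B).hom ≫ S.i ▷ (B ⊗ B) ≫ B ◁ uμ[B] ≫ uμ[B]) {Z : C} {f : Z ⟶ M.X}
    (hf : f ≫ M.q = f) : f ▷ B ≫ M.deformedAct = f ▷ B ≫ M.act := by
  obtain ⟨D⟩ := M.nonempty_comparison hh a
  have ea := (isInducedStructure_iff.1 D.induced).1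
  have e := D.n_ω
  have ei : D.coinv.i ≫ D.ω.inv = create _ uη[B] ≫ D.n := by
    rw [Iso.comp_inv_eq, Category.assoc, e, ← create_nat_assoc, M.isPreHopfModule.create_act,
      Category.comp_id]
  have hf' : f = (f ≫ D.coinv.p) ≫ D.coinv.i := by rw [Category.assoc, D.coinv.p_i, hf]
  have hu := create_join_left (A := B) D.coinv.obj
  rw [M.deformedAct_eq hh a, ← D.deformed_eq hh, Comparison.deformed, hf', comp_whiskerRight,
    Category.assoc, ← comp_whiskerRight_assoc D.coinv.i, ei]
  simp only [comp_whiskerRight, Category.assoc]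
  rw [reassoc_of% ea, e, reassoc_of% hu]

end StrongHopfModule

namespace IsBalancedTensor

variable {N : C} {Q : StrongHopfModule h S} {ψ : N ⊗ S.obj ⟶ N} {n : N ⊗ B ⟶ Q.X}

theorem n_q (ht : IsInducedStructure n Q.act Q.coact) :
    n ≫ Q.q = N ◁ S.p ≫ N ◁ S.i ≫ n := by
  obtain ⟨h₁, h₂⟩ := isInducedStructure_iff.1 ht
  rw [StrongHopfModule.q, coinvEndo, reassoc_of% h₂, ← whisker_exchange_assoc, h₁,
    ← whiskerLeft_comp_assoc, S.p_i, coinvEndo]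
  simp [split, join]

/-- On `n ⊗ b` the deformed action by `c` is `n ⊗ q(b₀) (h(b₁) c)`, and rebracketing around the
coinvariant `q(b₀)` gives `n ⊗ b c`. -/
theorem deformedAct_eq [IsIdempotentComplete C] [HasCoequalizers C]
    [PreservesColimitsOfShape WalkingParallelPair (tensorRight B)] (hh : IsAnchor h)
    (a : (S.i ▷ B ≫ uμ[B]) ▷ B ≫ uμ[B] =
      (α_ S.obj B B).hom ≫ S.i ▷ (B ⊗ B) ≫ B ◁ uμ[B] ≫ uμ[B])
    (hn : IsBalancedTensor S ψ n) (ht : IsInducedStructure n Q.act Q.coact) :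
    Q.deformedAct = Q.act := by
  obtain ⟨h₁, h₂⟩ := isInducedStructure_iff.1 ht
  have := hn.epi_whiskerRight B
  have ea := coinv_mul_assoc_strand a N
  have ec := coact_coinvEndo_hact_strand hh S N
  have e : n ≫ Q.coact ≫ Q.q ▷ H ≫ Q.X ◁ h =
      split N (coactB H B) ≫ (N ◁ S.p) ▷ H ≫ (N ⊗ S.obj) ◁ h ≫ (N ◁ S.i) ▷ B ≫ n ▷ B := by
    rw [reassoc_of% h₂, ← comp_whiskerRight_assoc, n_q ht]
    simp only [comp_whiskerRight, Category.assoc]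
    rw [← whisker_exchange, ← whisker_exchange_assoc]
  rw [Q.deformedAct_eq hh a, StrongHopfModule.twistedAct, ← cancel_epi (n ▷ B),
    ← comp_whiskerRight_assoc, e]
  simp only [comp_whiskerRight, Category.assoc]
  rw [join_nat_assoc, h₁, ← reassoc_of% ea]
  have ex : ((N ⊗ S.obj) ◁ h) ▷ B ≫ (N ◁ S.i) ▷ B ▷ B = (N ◁ S.i) ▷ H ▷ B ≫ ((N ⊗ B) ◁ h) ▷ B := by
    simp only [← comp_whiskerRight, whisker_exchange]
  have ej : ((N ⊗ B) ◁ h) ▷ B ≫ join N uμ[B] ▷ B = join N (hact h uμ[B]) ▷ B := by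
    rw [← comp_whiskerRight, whiskerLeft_join]
  have ed := congrArg (fun f => f ▷ B) ec
  simp only [comp_whiskerRight, id_whiskerRight] at ed
  rw [reassoc_of% ex, reassoc_of% ej, reassoc_of% ed]

end IsBalancedTensor

end Comparison

/-! ### The two module categories and the functors between them -/

section Functors

variable {C : Type u} [Category.{v} C] [MonoidalCategory C]

section RightModule

variable {A : C} [MonObj A] {N P R : RightModule A}

theorem RightModule.id_hom (N : RightModule A) : RightModule.Hom.hom (𝟙 N) = 𝟙 N.X := rfl

theorem RightModule.comp_hom (f : N ⟶ P) (g : P ⟶ R) : (f ≫ g).hom = f.hom ≫ g.hom := rfl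

theorem RightModule.hom_linear (f : N ⟶ P) : N.act ≫ f.hom = f.hom ▷ A ≫ P.act :=
  RightModule.Hom.linear f

theorem RightModule.isIso_of_inv (f : N ⟶ P) (g : P.X ⟶ N.X) (h₁ : f.hom ≫ g = 𝟙 _)
    (h₂ : g ≫ f.hom = 𝟙 _) : IsIso f := by
  have h₃ : P.act ≫ g = g ▷ A ≫ N.act := by
    have e : 𝟙 (P.X ⊗ A) = g ▷ A ≫ f.hom ▷ A := by rw [← comp_whiskerRight, h₂, id_whiskerRight]
    rw [← Category.id_comp (P.act ≫ g), e, Category.assoc, ← reassoc_of% RightModule.hom_linear f,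
      h₁, Category.comp_id]
  exact ⟨⟨⟨g, h₃⟩, RightModule.Hom.ext h₁, RightModule.Hom.ext h₂⟩⟩

end RightModule

variable [BraidedCategory C]
variable {H B : C} [UnitalMagma H] [ComonObj H] [WeakHopfQuasigroup H] [UnitalMagma B]
  [ComoduleMagma H B] {h : H ⟶ B} {S : BCoinv h}

namespace StrongHopfModule

variable {M Q R : StrongHopfModule h S}

theorem id_hom (M : StrongHopfModule h S) : Hom.hom (𝟙 M) = 𝟙 M.X := rfl

theorem comp_hom (f : M ⟶ Q) (g : Q ⟶ R) : (f ≫ g).hom = f.hom ≫ g.hom := rfl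

theorem hom_colinear (f : M ⟶ Q) : M.coact ≫ f.hom ▷ H = f.hom ≫ Q.coact :=
  Hom.colinear f

theorem hom_quasilinear (f : M ⟶ Q) : f.hom ▷ B ≫ Q.deformedAct = M.deformedAct ≫ f.hom :=
  Hom.quasilinear f

theorem isIso_of_inv (f : M ⟶ Q) (g : Q.X ⟶ M.X) (h₁ : f.hom ≫ g = 𝟙 _)
    (h₂ : g ≫ f.hom = 𝟙 _) : IsIso f := by
  have h₃ : Q.coact ≫ g ▷ H = g ≫ M.coact := by
    have e : 𝟙 (M.X ⊗ H) = f.hom ▷ H ≫ g ▷ H := by rw [← comp_whiskerRight, h₁, id_whiskerRight]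
    rw [← Category.comp_id (g ≫ M.coact), e, Category.assoc, reassoc_of% hom_colinear f,
      reassoc_of% h₂]
  have h₄ : g ▷ B ≫ M.deformedAct = Q.deformedAct ≫ g := by
    have e : 𝟙 (Q.X ⊗ B) = g ▷ B ≫ f.hom ▷ B := by rw [← comp_whiskerRight, h₂, id_whiskerRight]
    rw [← Category.id_comp (Q.deformedAct ≫ g), e, Category.assoc,
      reassoc_of% hom_quasilinear f, h₁, Category.comp_id]
  exact ⟨⟨⟨g, h₃, h₄⟩, Hom.ext h₁, Hom.ext h₂⟩⟩

theorem hom_q (hh : IsAnchor h) (g : M ⟶ Q) {Z : C} {f : Z ⟶ M.X} (hf : f ≫ M.q = f) :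
    f ≫ g.hom ≫ Q.q = f ≫ g.hom := by
  have ef := (M.isPreHopfModule.comp_coinvEndo_iff hh).1 hf
  have e := (Q.isPreHopfModule.comp_coinvEndo_iff hh (f := f ≫ g.hom)).2 (by
    simp only [Category.assoc]
    rw [← reassoc_of% hom_colinear g, rbar_nat, reassoc_of% ef, hom_colinear g])
  rw [Category.assoc] at e
  exact e

/-- Morphisms respect only the deformed actions, but these agree with the given ones on
coinvariants, which morphisms preserve. -/
theorem coinv_act_hom [IsIdempotentComplete C] [HasCoequalizers C]
    [PreservesColimitsOfShape WalkingParallelPair (tensorRight B)] (hh : IsAnchor h)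
    (a : (S.i ▷ B ≫ uμ[B]) ▷ B ≫ uμ[B] =
      (α_ S.obj B B).hom ≫ S.i ▷ (B ⊗ B) ≫ B ◁ uμ[B] ≫ uμ[B]) (g : M ⟶ Q)
    {Z : C} {f : Z ⟶ M.X} (hf : f ≫ M.q = f) :
    f ▷ B ≫ M.act ≫ g.hom = (f ≫ g.hom) ▷ B ≫ Q.act := by
  have e := M.i_deformedAct hh a hf
  have e' := Q.i_deformedAct hh a (f := f ≫ g.hom) (by rw [Category.assoc, hom_q hh g hf])
  rw [← reassoc_of% e, ← hom_quasilinear g, ← e', comp_whiskerRight_assoc]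

variable [MonObj S.obj]

/-- The right `B^{co H}`-module `M^{co H}`. -/
def coinvModule (M : StrongHopfModule h S) (hh : IsAnchor h)
    (h₁ : MonObj.one (X := S.obj) ≫ S.i = uη[B])
    (h₂ : MonObj.mul (X := S.obj) ≫ S.i = (S.i ⊗ₘ S.i) ≫ uμ[B]) (s : Splitting M.q) :
    RightModule S.obj where
  X := s.obj
  act := M.coinvAct s
  act_one := by
    have := s.mono_i
    rw [← cancel_mono s.i, Category.assoc, M.coinvAct_i hh, MonoidalCategory.tensorHom_def',
      Category.assoc, ← whiskerLeft_comp_assoc, h₁, whisker_exchange_assoc, M.act_unit,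
      rightUnitor_naturality]
  act_mul := by
    have := s.mono_i
    have e : (s.i ▷ S.obj ▷ S.obj ≫ (M.X ⊗ S.obj) ◁ S.i) ≫ _ = _ := _ ≫= M.act_coinv
    have e₁ : M.coinvAct s ▷ S.obj ≫ s.i ▷ S.obj =
        s.i ▷ S.obj ▷ S.obj ≫ (M.X ◁ S.i ≫ M.act) ▷ S.obj := by
      rw [← comp_whiskerRight, M.coinvAct_i hh, MonoidalCategory.tensorHom_def, Category.assoc,
        comp_whiskerRight]
    rw [← cancel_mono s.i]
    simp only [Category.assoc]
    rw [M.coinvAct_i hh, MonoidalCategory.tensorHom_def, Category.assoc, reassoc_of% e₁,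
      ← whisker_exchange_assoc]
    simp only [Category.assoc] at e
    rw [e, whisker_exchange_assoc, ← whiskerLeft_comp_assoc, h₂, MonoidalCategory.tensorHom_def']
    simp

/-- The morphism of coinvariants induced by a morphism of strong Hopf modules. -/
def coinvMap [IsIdempotentComplete C] [HasCoequalizers C]
    [PreservesColimitsOfShape WalkingParallelPair (tensorRight B)] (hh : IsAnchor h)
    (a : (S.i ▷ B ≫ uμ[B]) ▷ B ≫ uμ[B] =
      (α_ S.obj B B).hom ≫ S.i ▷ (B ⊗ B) ≫ B ◁ uμ[B] ≫ uμ[B])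
    (h₁ : MonObj.one (X := S.obj) ≫ S.i = uη[B])
    (h₂ : MonObj.mul (X := S.obj) ≫ S.i = (S.i ⊗ₘ S.i) ≫ uμ[B]) (s : Splitting M.q)
    (t : Splitting Q.q) (g : M ⟶ Q) :
    RightModule.Hom (M.coinvModule hh h₁ h₂ s) (Q.coinvModule hh h₁ h₂ t) where
  hom := s.i ≫ g.hom ≫ t.p
  linear := by
    have := t.mono_i
    have e : (s.i ≫ g.hom ≫ t.p) ≫ t.i = s.i ≫ g.hom := by
      rw [Category.assoc, Category.assoc, t.p_i, hom_q hh g s.i_comp]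
    have e' : (s.i ≫ g.hom ≫ t.p) ▷ S.obj ≫ t.i ▷ S.obj = (s.i ≫ g.hom) ▷ S.obj := by
      rw [← comp_whiskerRight, e]
    change M.coinvAct s ≫ s.i ≫ g.hom ≫ t.p = (s.i ≫ g.hom ≫ t.p) ▷ S.obj ≫ Q.coinvAct t
    rw [← cancel_mono t.i, Category.assoc, Category.assoc,
      Category.assoc, Category.assoc, t.p_i, hom_q hh g s.i_comp, reassoc_of% M.coinvAct_i hh s,
      Q.coinvAct_i hh t, MonoidalCategory.tensorHom_def', MonoidalCategory.tensorHom_def,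
      Category.assoc, Category.assoc, coinv_act_hom hh a g s.i_comp, reassoc_of% e',
      whisker_exchange_assoc]

end StrongHopfModule

theorem exists_coinvariantsFunctor [MonObj S.obj] [IsIdempotentComplete C] [HasCoequalizers C]
    [PreservesColimitsOfShape WalkingParallelPair (tensorRight B)] (hh : IsAnchor h)
    (a : (S.i ▷ B ≫ uμ[B]) ▷ B ≫ uμ[B] =
      (α_ S.obj B B).hom ≫ S.i ▷ (B ⊗ B) ≫ B ◁ uμ[B] ≫ uμ[B])
    (h₁ : MonObj.one (X := S.obj) ≫ S.i = uη[B])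
    (h₂ : MonObj.mul (X := S.obj) ≫ S.i = (S.i ⊗ₘ S.i) ≫ uμ[B]) :
    ∃ G : StrongHopfModule h S ⥤ RightModule S.obj, Nonempty (CoinvariantsFunctor G) := by
  have key (M : StrongHopfModule h S) : Nonempty (Splitting M.q) := by
    obtain ⟨D⟩ := M.nonempty_comparison hh a
    exact ⟨D.coinv⟩
  let s (M : StrongHopfModule h S) : Splitting M.q := (key M).some
  let G : StrongHopfModule h S ⥤ RightModule S.obj :=
    { obj M := M.coinvModule hh h₁ h₂ (s M)
      map {M Q} g := StrongHopfModule.coinvMap hh a h₁ h₂ (s M) (s Q) g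
      map_id M := by
        refine RightModule.Hom.ext ?_
        change (s M).i ≫ 𝟙 M.X ≫ (s M).p = 𝟙 (s M).obj
        rw [Category.id_comp, (s M).i_p]
      map_comp {M Q R} f g := by
        refine RightModule.Hom.ext ?_
        have e := StrongHopfModule.hom_q hh f (s M).i_comp
        change (s M).i ≫ (f.hom ≫ g.hom) ≫ (s R).p =
          ((s M).i ≫ f.hom ≫ (s Q).p) ≫ (s Q).i ≫ g.hom ≫ (s R).p
        simp only [Category.assoc]
        rw [reassoc_of% (s Q).p_i, reassoc_of% e] }
  exact ⟨G, ⟨{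
    i M := (s M).i
    p M := (s M).p
    p_i M := (s M).p_i
    i_p M := (s M).i_p
    act M := rfl
    map {M Q} g := by
      have e := StrongHopfModule.hom_q hh g (s M).i_comp
      change ((s M).i ≫ g.hom ≫ (s Q).p) ≫ (s Q).i = (s M).i ≫ g.hom
      rw [Category.assoc, Category.assoc, (s Q).p_i, e] }⟩⟩

/-- The morphism between induced strong Hopf modules determined by a morphism of modules. -/
theorem exists_induction_hom [MonObj S.obj] [IsIdempotentComplete C] [HasCoequalizers C]
    [PreservesColimitsOfShape WalkingParallelPair (tensorRight B)] (hh : IsAnchor h)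
    (a : (S.i ▷ B ≫ uμ[B]) ▷ B ≫ uμ[B] =
      (α_ S.obj B B).hom ≫ S.i ▷ (B ⊗ B) ≫ B ◁ uμ[B] ≫ uμ[B]) {N P : RightModule S.obj}
    (f : N ⟶ P) {M Q : StrongHopfModule h S} {n : N.X ⊗ B ⟶ M.X} {m : P.X ⊗ B ⟶ Q.X}
    (hn : IsBalancedTensor S N.act n) (tn : IsInducedStructure n M.act M.coact)
    (hm : IsBalancedTensor S P.act m) (tm : IsInducedStructure m Q.act Q.coact) :
    ∃ g : M ⟶ Q, n ≫ g.hom = f.hom ▷ B ≫ m := by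
  have := hn.epi
  have := hn.epi_whiskerRight B
  obtain ⟨a₁, c₁⟩ := isInducedStructure_iff.1 tn
  obtain ⟨a₂, c₂⟩ := isInducedStructure_iff.1 tm
  have e : f.hom ▷ S.obj ▷ B ≫ (P.X ◁ S.i) ▷ B = (N.X ◁ S.i) ▷ B ≫ f.hom ▷ B ▷ B := by
    simp only [← comp_whiskerRight, whisker_exchange]
  obtain ⟨g, hg⟩ := hn.exists_desc (f.hom ▷ B ≫ m) (by
    rw [← comp_whiskerRight_assoc, RightModule.hom_linear f, comp_whiskerRight_assoc, hm.eq,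
      reassoc_of% e, join_nat_assoc])
  refine ⟨⟨g, ?_, ?_⟩, hg⟩
  · rw [← cancel_epi n, reassoc_of% c₁, ← comp_whiskerRight, hg, reassoc_of% hg, c₂,
      split_nat_assoc, comp_whiskerRight]
  · rw [IsBalancedTensor.deformedAct_eq hh a hn tn, IsBalancedTensor.deformedAct_eq hh a hm tm,
      ← cancel_epi (n ▷ B), reassoc_of% a₁, ← comp_whiskerRight_assoc, hg,
      comp_whiskerRight_assoc, a₂, join_nat_assoc]

theorem exists_inductionFunctor [MonObj S.obj] [IsIdempotentComplete C] [HasCoequalizers C]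
    [PreservesColimitsOfShape WalkingParallelPair (tensorRight B)]
    [PreservesColimitsOfShape WalkingParallelPair (tensorRight H)] (hh : IsAnchor h)
    (a : (B ◁ S.i ≫ uμ[B]) ▷ B ≫ uμ[B] =
      (α_ B S.obj B).hom ≫ B ◁ (S.i ▷ B ≫ uμ[B]) ≫ uμ[B])
    (a' : (S.i ▷ B ≫ uμ[B]) ▷ B ≫ uμ[B] =
      (α_ S.obj B B).hom ≫ S.i ▷ (B ⊗ B) ≫ B ◁ uμ[B] ≫ uμ[B]) :
    ∃ F : RightModule S.obj ⥤ StrongHopfModule h S, Nonempty (InductionFunctor F) := by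
  have key (N : RightModule S.obj) : ∃ (Q : StrongHopfModule h S) (n : N.X ⊗ B ⟶ Q.X),
      IsBalancedTensor S N.act n ∧ IsInducedStructure n Q.act Q.coact := by
    obtain ⟨T, n, hn⟩ := IsBalancedTensor.exists_of_hasCoequalizers S N.act
    obtain ⟨tact, tcoact, ht⟩ := hn.exists_isInducedStructure hh a'
    exact ⟨hn.strongHopfModule hh a ht, n, hn, ht⟩
  choose Q n hn ht using key
  choose map hmap using fun {N P : RightModule S.obj} (f : N ⟶ P) =>
    exists_induction_hom hh a' f (hn N) (ht N) (hn P) (ht P)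
  let F : RightModule S.obj ⥤ StrongHopfModule h S :=
    { obj := Q
      map f := map f
      map_id N := by
        have := (hn N).epi
        refine StrongHopfModule.Hom.ext ?_
        rw [← cancel_epi (n N), hmap, RightModule.id_hom, StrongHopfModule.id_hom]
        simp
      map_comp {N P R} f g := by
        have := (hn N).epi
        refine StrongHopfModule.Hom.ext ?_
        rw [← cancel_epi (n N), hmap, RightModule.comp_hom, StrongHopfModule.comp_hom,
          reassoc_of% hmap f, hmap, comp_whiskerRight_assoc] }
  exact ⟨F, ⟨⟨n, hn, ht, fun f => hmap f⟩⟩⟩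

end Functors

/-! ### The adjoint equivalence -/

section Equivalence

variable {C : Type u} [Category.{v} C] [MonoidalCategory C] [BraidedCategory C]
variable {H B : C} [UnitalMagma H] [ComonObj H] [WeakHopfQuasigroup H] [UnitalMagma B]
  [ComoduleMagma H B] {h : H ⟶ B} {S : BCoinv h}

/-- The strong Hopf module `B`. -/
def IsAnchor.strongHopfModule (hh : IsAnchor h) (S : BCoinv h)
    (a : (B ◁ S.i ≫ uμ[B]) ▷ B ≫ uμ[B] =
      (α_ B S.obj B).hom ≫ B ◁ (S.i ▷ B ≫ uμ[B]) ≫ uμ[B]) : StrongHopfModule h S where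
  X := B
  act := uμ[B]
  coact := coactB H B
  comodule := hh.isPreHopfModule.comodule
  act_unit := hh.isPreHopfModule.act_unit
  act_coinv := a
  act_coact := hh.isPreHopfModule.act_coact
  act_target := hh.isPreHopfModule.act_target
  act_source := hh.isPreHopfModule.act_source

theorem IsBalancedTensor.create_n_q (hh : IsAnchor h) {N : C} {Q : StrongHopfModule h S}
    {n : N ⊗ B ⟶ Q.X} (ht : IsInducedStructure n Q.act Q.coact) :
    (create N uη[B] ≫ n) ≫ Q.q = create N uη[B] ≫ n := by
  rw [Category.assoc, n_q ht, create, Category.assoc, ← whiskerLeft_comp_assoc,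
    ← whiskerLeft_comp_assoc, Category.assoc, S.p_i, hh.unit_comp_coinvEndo, Category.assoc]

variable [MonObj S.obj]

/-- The case `M = B` of `act_p`: `p_B` is left linear over the coinvariants. -/
theorem coinv_mul_p (hh : IsAnchor h)
    (a : (B ◁ S.i ≫ uμ[B]) ▷ B ≫ uμ[B] =
      (α_ B S.obj B).hom ≫ B ◁ (S.i ▷ B ≫ uμ[B]) ≫ uμ[B])
    (h₂ : MonObj.mul (X := S.obj) ≫ S.i = (S.i ⊗ₘ S.i) ≫ uμ[B]) :
    S.i ▷ B ≫ uμ[B] ≫ S.p = S.obj ◁ S.p ≫ MonObj.mul := by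
  have e := (hh.strongHopfModule S a).act_p hh S
  have e' : (hh.strongHopfModule S a).coinvAct S = MonObj.mul := by
    change (S.i ⊗ₘ S.i) ≫ uμ[B] ≫ S.p = _
    rw [← reassoc_of% h₂, S.i_p, Category.comp_id]
  rw [← e']
  exact e

/-- The image of `q_M` underlying a functor of coinvariants. -/
abbrev CoinvariantsFunctor.splitting {G : StrongHopfModule h S ⥤ RightModule S.obj}
    (dG : CoinvariantsFunctor G) (M : StrongHopfModule h S) : Splitting M.q :=
  ⟨(G.obj M).X, dG.i M, dG.p M, dG.p_i M, dG.i_p M⟩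

theorem CoinvariantsFunctor.act_i {G : StrongHopfModule h S ⥤ RightModule S.obj}
    (dG : CoinvariantsFunctor G) (hh : IsAnchor h) (M : StrongHopfModule h S) :
    (G.obj M).act ≫ dG.i M = (dG.i M ⊗ₘ S.i) ≫ M.act := by
  rw [dG.act]
  exact M.coinvAct_i hh (dG.splitting M)

variable [PreservesColimitsOfShape WalkingParallelPair (tensorRight B)]
variable {F : RightModule S.obj ⥤ StrongHopfModule h S} (dF : InductionFunctor F)
  {G : StrongHopfModule h S ⥤ RightModule S.obj} (dG : CoinvariantsFunctor G)
include dF dG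

theorem exists_unit_hom (hh : IsAnchor h)
    (a : (B ◁ S.i ≫ uμ[B]) ▷ B ≫ uμ[B] =
      (α_ B S.obj B).hom ≫ B ◁ (S.i ▷ B ≫ uμ[B]) ≫ uμ[B])
    (h₁ : MonObj.one (X := S.obj) ≫ S.i = uη[B])
    (h₂ : MonObj.mul (X := S.obj) ≫ S.i = (S.i ⊗ₘ S.i) ≫ uμ[B]) (N : RightModule S.obj) :
    ∃ f : N ⟶ G.obj (F.obj N),
      f.hom ≫ dG.i (F.obj N) = create N.X uη[B] ≫ dF.n N ∧ IsIso f := by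
  have := (dG.splitting (F.obj N)).mono_i
  have hn := dF.isBalancedTensor N
  have ht := dF.induced N
  have := hn.epi
  have hq := IsBalancedTensor.create_n_q hh ht
  have hnq := IsBalancedTensor.n_q ht
  have hi := (dG.splitting (F.obj N)).i_comp
  obtain ⟨ta, -⟩ := isInducedStructure_iff.1 ht
  obtain ⟨f, hf⟩ : ∃ f : N.X ⟶ (G.obj (F.obj N)).X,
      f ≫ dG.i (F.obj N) = create N.X uη[B] ≫ dF.n N :=
    ⟨create N.X uη[B] ≫ dF.n N ≫ dG.p (F.obj N), by
      simpa only [Category.assoc, dG.p_i] using hq⟩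
  have hu := create_join (A := B) N.X
  have hu' := create_join_left (A := B) N.X
  have hl : N.act ≫ create N.X uη[B] ≫ dF.n N = N.X ◁ S.i ≫ dF.n N := by
    rw [create_nat_assoc, hn.eq, ← create_nat_assoc, reassoc_of% hu]
  have hlin : N.act ≫ f = f ▷ S.obj ≫ (G.obj (F.obj N)).act := by
    rw [← cancel_mono (dG.i (F.obj N)), Category.assoc, Category.assoc, hf, hl, dG.act_i hh,
      MonoidalCategory.tensorHom_def, Category.assoc, ← comp_whiskerRight_assoc, hf,
      ← whisker_exchange_assoc, comp_whiskerRight_assoc, ta, reassoc_of% hu']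
  -- The inverse of the unit is the restriction to coinvariants of `n ⊗ b ↦ n p(b)`, which is
  -- balanced by left linearity of `p`.
  obtain ⟨r, hr⟩ := hn.exists_desc (N.X ◁ S.p ≫ N.act) (by
    have e := coinv_mul_p hh a h₂
    have e' : join N.X uμ[B] ≫ N.X ◁ S.p = (α_ N.X B B).hom ≫ N.X ◁ (uμ[B] ≫ S.p) := by
      simp [join]
    have e₁ := N.act_mul
    rw [← whisker_exchange_assoc, e₁, reassoc_of% e', associator_naturality_middle_assoc,
      ← whiskerLeft_comp_assoc, e, whiskerLeft_comp_assoc, associator_naturality_right_assoc])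
  have hr' : r ≫ create N.X uη[B] ≫ dF.n N = (F.obj N).q := by
    rw [← cancel_epi (dF.n N), reassoc_of% hr, hl, hnq]
  have h₁' : uη[B] ≫ S.p = MonObj.one (X := S.obj) := by
    rw [← h₁, Category.assoc, S.i_p, Category.comp_id]
  refine ⟨⟨f, hlin⟩, hf, RightModule.isIso_of_inv _ (dG.i (F.obj N) ≫ r) ?_ ?_⟩
  · change f ≫ dG.i (F.obj N) ≫ r = 𝟙 N.X
    rw [reassoc_of% hf, hr, create, Category.assoc, ← whiskerLeft_comp_assoc, h₁', N.act_one,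
      Iso.inv_hom_id]
  · change (dG.i (F.obj N) ≫ r) ≫ f = 𝟙 (G.obj (F.obj N)).X
    rw [← cancel_mono (dG.i (F.obj N)), Category.assoc, Category.assoc, hf, hr', hi,
      Category.id_comp]

/-- The counit is the comparison isomorphism. The deformed action of its source is the induced
action, so quasilinearity is the definition of the deformed action of `M`. -/
theorem exists_counit_hom [IsIdempotentComplete C] [HasCoequalizers C] (hh : IsAnchor h)
    (a : (S.i ▷ B ≫ uμ[B]) ▷ B ≫ uμ[B] =
      (α_ S.obj B B).hom ≫ S.i ▷ (B ⊗ B) ≫ B ◁ uμ[B] ≫ uμ[B]) (M : StrongHopfModule h S) :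
    ∃ f : F.obj (G.obj M) ⟶ M, dF.n (G.obj M) ≫ f.hom = dG.i M ▷ B ≫ M.act ∧ IsIso f := by
  have hn := dF.isBalancedTensor (G.obj M)
  have ht := dF.induced (G.obj M)
  have ha := IsBalancedTensor.deformedAct_eq hh a hn ht
  rw [dG.act] at hn
  obtain ⟨ω, hω, hc⟩ := M.exists_comparisonIso hh (dG.splitting M) hn ht
  let D : M.Comparison := ⟨dG.splitting M, _, _, hn, _, _, ht, ω, hω, hc⟩
  have hD : M.deformedAct = ω.inv ▷ B ≫ (F.obj (G.obj M)).act ≫ ω.hom := by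
    rw [M.deformedAct_eq hh a, ← D.deformed_eq hh]
    rfl
  refine ⟨⟨ω.hom, hc.symm, ?_⟩, hω, StrongHopfModule.isIso_of_inv _ ω.inv ω.hom_inv_id
    ω.inv_hom_id⟩
  rw [ha, hD, hom_inv_whiskerRight_assoc]

theorem exists_unit (hh : IsAnchor h)
    (a : (B ◁ S.i ≫ uμ[B]) ▷ B ≫ uμ[B] =
      (α_ B S.obj B).hom ≫ B ◁ (S.i ▷ B ≫ uμ[B]) ≫ uμ[B])
    (h₁ : MonObj.one (X := S.obj) ≫ S.i = uη[B])
    (h₂ : MonObj.mul (X := S.obj) ≫ S.i = (S.i ⊗ₘ S.i) ≫ uμ[B]) :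
    ∃ η : 𝟭 (RightModule S.obj) ⟶ F ⋙ G,
      (∀ N, (η.app N).hom ≫ dG.i (F.obj N) = create N.X uη[B] ≫ dF.n N) ∧ IsIso η := by
  choose η hη iso using exists_unit_hom dF dG hh a h₁ h₂
  let η' : 𝟭 (RightModule S.obj) ⟶ F ⋙ G :=
    { app := η
      naturality N P f := by
        have := (dG.splitting (F.obj P)).mono_i
        refine RightModule.Hom.ext ?_
        change f.hom ≫ (η P).hom = (η N).hom ≫ (G.map (F.map f)).hom
        rw [← cancel_mono (dG.i (F.obj P)), Category.assoc, Category.assoc, hη, dG.map,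
          reassoc_of% hη N, dF.map, create_nat_assoc] }
  have (N : RightModule S.obj) : IsIso (η'.app N) := iso N
  exact ⟨η', hη, NatIso.isIso_of_isIso_app η'⟩

theorem exists_counit [IsIdempotentComplete C] [HasCoequalizers C] (hh : IsAnchor h)
    (a : (S.i ▷ B ≫ uμ[B]) ▷ B ≫ uμ[B] =
      (α_ S.obj B B).hom ≫ S.i ▷ (B ⊗ B) ≫ B ◁ uμ[B] ≫ uμ[B]) :
    ∃ κ : G ⋙ F ⟶ 𝟭 (StrongHopfModule h S),
      (∀ M, dF.n (G.obj M) ≫ (κ.app M).hom = dG.i M ▷ B ≫ M.act) ∧ IsIso κ := by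
  choose κ hκ iso using exists_counit_hom dF dG hh a
  let κ' : G ⋙ F ⟶ 𝟭 (StrongHopfModule h S) :=
    { app := κ
      naturality M Q g := by
        have := (dF.isBalancedTensor (G.obj M)).epi
        have e := StrongHopfModule.coinv_act_hom hh a g (dG.splitting M).i_comp
        refine StrongHopfModule.Hom.ext ?_
        change (F.map (G.map g)).hom ≫ (κ Q).hom = (κ M).hom ≫ g.hom
        rw [← cancel_epi (dF.n (G.obj M)), reassoc_of% dF.map (G.map g), hκ,
          reassoc_of% hκ M, e, ← comp_whiskerRight_assoc, dG.map] }
  have (M : StrongHopfModule h S) : IsIso (κ'.app M) := iso M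
  exact ⟨κ', hκ, NatIso.isIso_of_isIso_app κ'⟩

theorem exists_adjunction [IsIdempotentComplete C] [HasCoequalizers C] (hh : IsAnchor h)
    (a : (B ◁ S.i ≫ uμ[B]) ▷ B ≫ uμ[B] =
      (α_ B S.obj B).hom ≫ B ◁ (S.i ▷ B ≫ uμ[B]) ≫ uμ[B])
    (a' : (S.i ▷ B ≫ uμ[B]) ▷ B ≫ uμ[B] =
      (α_ S.obj B B).hom ≫ S.i ▷ (B ⊗ B) ≫ B ◁ uμ[B] ≫ uμ[B])
    (h₁ : MonObj.one (X := S.obj) ≫ S.i = uη[B])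
    (h₂ : MonObj.mul (X := S.obj) ≫ S.i = (S.i ⊗ₘ S.i) ≫ uμ[B]) :
    ∃ adj : F ⊣ G,
      (∀ N, (adj.unit.app N).hom ≫ dG.i (F.obj N) = (ρ_ N.X).inv ≫ N.X ◁ uη[B] ≫ dF.n N) ∧
      (∀ M, dF.n (G.obj M) ≫ (adj.counit.app M).hom = dG.i M ▷ B ≫ M.act) ∧
      IsIso adj.unit ∧ IsIso adj.counit := by
  obtain ⟨η, hη, iη⟩ := exists_unit dF dG hh a h₁ h₂
  obtain ⟨κ, hκ, iκ⟩ := exists_counit dF dG hh a'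
  refine ⟨Adjunction.mkOfUnitCounit ⟨η, κ, ?_, ?_⟩, fun N => ?_, hκ, iη, iκ⟩
  -- First triangle, tested on `n ⊗ b`, which goes to `(n ⊗ 1) b = n ⊗ b`.
  · ext N
    have := (dF.isBalancedTensor N).epi
    have hu := create_join_left (A := B) N.X
    have ta := (isInducedStructure_iff.1 (dF.induced N)).1
    refine StrongHopfModule.Hom.ext ?_
    change (F.map (η.app N)).hom ≫ 𝟙 _ ≫ (κ.app (F.obj N)).hom = 𝟙 (F.obj N).X
    rw [Category.id_comp, ← cancel_epi (dF.n N), reassoc_of% dF.map (η.app N), Category.comp_id]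
    change (η.app N).hom ▷ B ≫ dF.n (G.obj (F.obj N)) ≫ (κ.app (F.obj N)).hom = dF.n N
    rw [hκ, ← comp_whiskerRight_assoc]
    exact (congrArg (fun f => f ▷ B ≫ (F.obj N).act) (hη N)).trans (by
      rw [comp_whiskerRight_assoc, ta, reassoc_of% hu])
  -- Second triangle, tested after the monomorphism `i_M`: it reduces to `m 1 = m`.
  · ext M
    have := (dG.splitting M).mono_i
    refine RightModule.Hom.ext ?_
    change (η.app (G.obj M)).hom ≫ 𝟙 _ ≫ (G.map (κ.app M)).hom = 𝟙 (G.obj M).X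
    rw [Category.id_comp, ← cancel_mono (dG.i M), Category.assoc]
    refine (congrArg (fun f => (η.app (G.obj M)).hom ≫ f) (dG.map (κ.app M))).trans ?_
    refine (reassoc_of% hη (G.obj M)) (κ.app M).hom |>.trans ?_
    rw [hκ, ← create_nat_assoc, M.isPreHopfModule.create_act, Category.comp_id]
    exact (Category.id_comp _).symm
  · refine (hη N).trans ?_
    rw [create, Category.assoc]

end Equivalence

end WeakDoiHopf

open WeakDoiHopf in
theorem theorem3p3 {C : Type*} [Category C] [MonoidalCategory C] [BraidedCategory C]
    [IsIdempotentComplete C] [HasCoequalizers C]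
    (H B : C) [UnitalMagma H] [ComonObj H] [WeakHopfQuasigroup H]
    [UnitalMagma B] [ComoduleMagma H B]
    [PreservesColimitsOfShape WalkingParallelPair (tensorRight B)]
    [PreservesColimitsOfShape WalkingParallelPair (tensorRight H)]
    (h : H ⟶ B) (hh : IsAnchor h) :
    -- the coinvariants of `B` exist
    Nonempty (BCoinv h) ∧
    ∀ (S : BCoinv h)
      (_ : (B ◁ S.i ≫ uμ[B]) ▷ B ≫ uμ[B] =
        (α_ B S.obj B).hom ≫ B ◁ (S.i ▷ B ≫ uμ[B]) ≫ uμ[B])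
      (_ : (S.i ▷ B ≫ uμ[B]) ▷ B ≫ uμ[B] =
        (α_ S.obj B B).hom ≫ S.i ▷ (B ⊗ B) ≫ B ◁ uμ[B] ≫ uμ[B]),
      -- `B^{co H}` is a monoid, with the unit and product inherited from `B`
      ∃ m : MonObj S.obj,
        m.one ≫ S.i = uη[B] ∧ m.mul ≫ S.i = (S.i ⊗ₘ S.i) ≫ uμ[B] ∧
        -- the comparison isomorphisms exist, and the deformed actions do not depend on choices
        (∀ M : StrongHopfModule h S,
          Nonempty M.Comparison ∧ ∀ D : M.Comparison, M.deformedAct = D.deformed) ∧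
        -- the two functors exist
        (∃ F : RightModule S.obj ⥤ StrongHopfModule h S, Nonempty (InductionFunctor F)) ∧
        (∃ G : StrongHopfModule h S ⥤ RightModule S.obj, Nonempty (CoinvariantsFunctor G)) ∧
        -- they are adjoint, with invertible unit and counit
        (∀ (F : RightModule S.obj ⥤ StrongHopfModule h S) (dF : InductionFunctor F)
          (G : StrongHopfModule h S ⥤ RightModule S.obj) (dG : CoinvariantsFunctor G),
          ∃ adj : F ⊣ G,
            (∀ N, (adj.unit.app N).hom ≫ dG.i (F.obj N) =
              (ρ_ N.X).inv ≫ N.X ◁ uη[B] ≫ dF.n N) ∧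
            (∀ M, dF.n (G.obj M) ≫ (adj.counit.app M).hom = dG.i M ▷ B ≫ M.act) ∧
            IsIso adj.unit ∧ IsIso adj.counit) ∧
        -- the two categories are equivalent
        Nonempty (StrongHopfModule h S ≌ RightModule S.obj) := by
  refine ⟨hh.nonempty_bCoinv, fun S a a' => ?_⟩
  let m := coinvMonObj hh S a'
  have h₁ : m.one ≫ S.i = uη[B] := by
    change (uη[B] ≫ S.p) ≫ S.i = uη[B]
    rw [Category.assoc, S.p_i, hh.unit_comp_coinvEndo]
  have h₂ : m.mul ≫ S.i = (S.i ⊗ₘ S.i) ≫ uμ[B] := by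
    change ((S.i ⊗ₘ S.i) ≫ uμ[B] ≫ S.p) ≫ S.i = (S.i ⊗ₘ S.i) ≫ uμ[B]
    rw [Category.assoc, Category.assoc, S.p_i,
      hh.isPreHopfModule.act_coinv_coinvEndo hh S.i_comp S.i_comp]
  obtain ⟨F, ⟨dF⟩⟩ := exists_inductionFunctor hh a a'
  obtain ⟨G, ⟨dG⟩⟩ := exists_coinvariantsFunctor hh a' h₁ h₂
  refine ⟨m, h₁, h₂, fun M => ⟨M.nonempty_comparison hh a', fun D => ?_⟩, ⟨F, ⟨dF⟩⟩,
    ⟨G, ⟨dG⟩⟩, fun F dF G dG => exists_adjunction dF dG hh a a' h₁ h₂, ?_⟩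
  · rw [M.deformedAct_eq hh a', D.deformed_eq hh]
  · obtain ⟨adj, -, -, _, _⟩ := exists_adjunction dF dG hh a a' h₁ h₂
    exact ⟨adj.toEquivalence.symm⟩
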